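/- **Setting.** An automata network over a finite alphabet $Q$ with finite node set $V$ is a map $F:Q^V\to Q^V$; a family is a set of such networks (nodes being numbered, up to renaming). The interaction graph of $F$ has an edge $u\to v$ if $F(x)_v$ effectively depends on $x_u$. A configuration lies in an attractor if it belongs to $\bigcap_{t\ge 0}F^t(Q^V)$. For a set $\mathcal G$ of gates $g:Q^{i(g)}\to Q^{o(g)}$, a $\mathcal G$-network with node set $V$ is obtained from a finite list of gates of $\mathcal G$ by wiring every input to exactly one output and every output to exactly one input (each wire is a node, and its next state is the value of its output), no output of a gate being wired to an input of the same gate. Let $\mathcal G_t$ be the set of the following gates over $\{0,1,2\}$. Three gates $Q^2\to Q$ give $2$ as soon as one of $x,y$ is $2$, and on $\{0,1\}^2$ are: $\mathrm{AND}_{\{0,1\}}(x,y)=x\wedge y$; $\mathrm{AND}_2(x,y)=2$ if $x=y=1$ and $0$ otherwise; $\Lambda(x,y)=x$. The other two are $\mathrm{Id}(x)=x$ and $\Upsilon(x)=(x,x)$. *Super-polynomial transients.* A family $\mathcal F$ has super-polynomial transients if there are $\alpha,c>0$ and $K$ such that for every $n\ge 1$ there are $F_n\in\mathcal F$ with at most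 $Kn$ nodes, a configuration $x$ and a time $t\ge c\exp(n^\alpha)$ such that $F_n^t(x)$ is not in an attractor of $F_n$. *Coherent gadgets.* Fix an interface $C=C_i\sqcup C_o$. A gadget is a network $F$ on $V_F$ with input maps $\phi^i_k:C\to V_F$ and output maps $\phi^o_k:C\to V_F$, all injective with pairwise disjoint images. Gadgets $F,G$ are glued by identifying, along the copies of $C$, selected inputs of $F$ with selected outputs of $G$ and selected outputs of $F$ with selected inputs of $G$; on an identified copy, a node of $C_i$ follows the local rule of the gadget for which the copy is an input, a node of $C_o$ that of the gadget for which it is an output, and all other nodes keep their rule; the unused inputs and outputs remain. A family $\mathcal F$ over a finite alphabet $R$ has coherent $\mathcal G$-gadgets if there are an interface $C$; for each $g\in\mathcal G$ a gadget $F_g$ with $i(g)$ inputs and $o(g)$ outputs, such that the closure of these gadgets under copies, disjoint unions and glueings is contained in $\mathcal F$; an injective map $q\mapsto s_q\in R^C$; for each $g$ a configuration $c_g$ of the nodes of $F_g$ outside the interface copies; a time $T$; and traces $\tau_{q,q'}:\{0,\dots,T\}\to R^C$ with $\tau_{q,q'}(0)=s_q$, $\tau_{q,q'}(T)=s_{q'}$,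 such that for all $g$ and all tuples of states with $g(q_{i,1},\dots,q_{i,i(g)})=(q'_{o,1},\dots,q'_{o,o(g)})$ (the tuples $q'_{i,\cdot}$ and $q_{o,\cdot}$ being arbitrary) there is a sequence $(x^s)_{0\le s\le T}$ that satisfies $x^{s+1}_v=F_g(x^s)_v$ for $s<T$ at every node $v$ outside $\bigcup_k\phi^i_{k}(C_o)\cup\bigcup_k\phi^o_{k}(C_i)$, whose trace on the $k$-th input copy of $C$ is $\tau_{q_{i,k},q'_{i,k}}$ and on the $k$-th output copy is $\tau_{q_{o,k},q'_{o,k}}$, and which equals $c_g$ outside the interface copies at the times $0$ and $T$. *Universality.* A network $G:R^W\to R^W$ simulates $F:Q^V\to Q^V$ with time constant $T$ via a block embedding $\phi$ if $\phi\circ F=G^T\circ\phi$, where $\phi(x)|_{D_i}=p_{i,x_i}$ for a partition $W=\bigsqcup_{i\in V}D_i$ and patterns $p_{i,q}\in R^{D_i}$ that for each $i$ are distinct for distinct $q$. A family with a representation of its members by binary words is universal if for every alphabet $Q$ and every polynomial $P$ there are polynomially bounded $T,S:\mathbb N\to\mathbb N$ and a deterministic logarithmic-space Turing machine that, given any Boolean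 circuit of size at most $P(n)$ encoding a network $F:Q^n\to Q^n$, outputs a word representing a member of the family with $S(n)$ nodes, the number $T(n)$, and a block embedding via which this member simulates $F$ with time constant $T(n)$. **Theorem.** 1. The family of $\mathcal G_t$-networks has super-polynomial transients, and so does every family (over any finite alphabet) that has coherent $\mathcal G_t$-gadgets. 2. The family of $\mathcal G_t$-networks, with its bounded degree representation (a communication graph of degree at most $\Delta$ together with the transition tables of the nodes, for any $\Delta$), is not universal. This holds even without any requirement that the simulation be computable: it is not true that for every alphabet $Q$ and polynomial $P$ there are polynomially bounded $T,S$ such that each network $F:Q^n\to Q^n$ with a circuit encoding of size at most $P(n)$ is simulated by some $\mathcal G_t$-network with at most $S(n)$ nodes with time constant at most $T(n)$. 3. Let $F$ be a $\mathcal G_t$-network with $n$ nodes, $x$ a configuration with periodic orbit, and $v$ a node. If $v$ lies on a directed cycle of the interaction graph of $F$, then there is $1\le p\le n$ such that $F^{s+p}(x)_v=2\Leftrightarrow F^s(x)_v=2$ for all $s\ge0$. If $v$ lies on a directed cycle of the Boolean interaction graph of $F$ (edges $u\to v$ such that $F(y)_v$ effectively depends on $y_u$ when $y$ ranges over $\{0,1\}^V$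 only), then the trace $s\mapsto F^s(x)_v$ has a period $p$ with $1\le p\le n$, in particular $p<n^2$. -/

import Mathlib

/-! ### Automata networks -/

/-- An automata network over the alphabet `Q` with node set `V`. -/
abbrev Network (Q V : Type) : Type := (V → Q) → V → Q

/-- A family of automata networks over `Q`; the nodes of a network with `n` nodes are numbered. -/
abbrev NetworkFamily (Q : Type) : Type := ∀ n : ℕ, Set (Network Q (Fin n))

/-- The network `F` transported along a renaming of its nodes. -/
def Network.rename {Q V W : Type} (e : V ≃ W) (F : Network Q V) : Network Q W :=
  fun x w => F (fun v => x (e v)) (e.symm w)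

/-- The family contains the network `F`, once the nodes of `F` are numbered suitably. -/
def NetworkFamily.Contains {Q V : Type} (𝓕 : NetworkFamily Q) (F : Network Q V) : Prop :=
  ∃ (n : ℕ) (e : V ≃ Fin n), F.rename e ∈ 𝓕 n

/-- The limit configurations of `F`, i.e. the configurations that lie in an attractor. -/
def Network.limitSet {Q V : Type} (F : Network Q V) : Set (V → Q) :=
  ⋂ t : ℕ, Set.range (F^[t])

open Classical in
/-- `u → v` is an edge of the interaction graph of `F`: the next state of `v` effectively depends
on the state of `u`. -/
def Network.Edge {Q V : Type} (F : Network Q V) (u v : V) : Prop :=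
  ∃ (x : V → Q) (a : Q), F (Function.update x u a) v ≠ F x v

/-- There is `α > 0` such that for every `n ≥ 1` the family has a network with `O(n)` nodes and a
configuration that is still outside the attractors after `t` steps, with `t` in
`Ω(exp (n ^ α))`. -/
def NetworkFamily.HasSuperpolynomialTransients {Q : Type} (𝓕 : NetworkFamily Q) : Prop :=
  ∃ α : ℝ, 0 < α ∧ ∃ (K : ℕ) (c : ℝ), 0 < c ∧
    ∀ n : ℕ, 1 ≤ n →
      ∃ m : ℕ, m ≤ K * n ∧ ∃ F ∈ 𝓕 m, ∃ (x : Fin m → Q) (t : ℕ),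
        c * Real.exp ((n : ℝ) ^ α) ≤ (t : ℝ) ∧ F^[t] x ∉ F.limitSet

/-! ### Gates and networks of gates -/

/-- A gate: a map `Q ^ arity → Q ^ coarity`. -/
structure Gate (Q : Type) where
  arity : ℕ
  coarity : ℕ
  map : (Fin arity → Q) → Fin coarity → Q

/-- A wiring of gates taken from `𝓖` with node set `V`. Each node is one input (via `inputs`) and
one output (via `outputs`) of some gate; no output of a gate is wired to an input of that gate. -/
structure Wiring {Q : Type} (𝓖 : Set (Gate Q)) (V : Type) where
  numGates : ℕ
  gate : Fin numGates → Gate Q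
  gate_mem : ∀ j, gate j ∈ 𝓖
  inputs : (Σ j : Fin numGates, Fin (gate j).arity) ≃ V
  outputs : V ≃ (Σ j : Fin numGates, Fin (gate j).coarity)
  no_self_loop : ∀ p, (outputs (inputs p)).1 ≠ p.1

/-- The automata network of a wiring. -/
def Wiring.network {Q V : Type} {𝓖 : Set (Gate Q)} (W : Wiring 𝓖 V) : Network Q V :=
  fun x v => (W.gate (W.outputs v).1).map
    (fun k => x (W.inputs ⟨(W.outputs v).1, k⟩)) (W.outputs v).2

/-- The family of all `𝓖`-networks. -/
def gateNetworks {Q : Type} (𝓖 : Set (Gate Q)) : NetworkFamily Q :=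
  fun n => {F | ∃ W : Wiring 𝓖 (Fin n), W.network = F}

/-- Conjunction on `{0,1}`, with `2` spreading. -/
def gateAnd01 : Gate (Fin 3) where
  arity := 2
  coarity := 1
  map := fun x _ => if x 0 = 2 ∨ x 1 = 2 then 2 else min (x 0) (x 1)

/-- State `2` if an input is `2` or if both are `1`, and `0` otherwise. -/
def gateAnd2 : Gate (Fin 3) where
  arity := 2
  coarity := 1
  map := fun x _ => if x 0 = 2 ∨ x 1 = 2 ∨ (x 0 = 1 ∧ x 1 = 1) then 2 else 0

/-- The first input, unless one of the inputs is `2`. -/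
def gateLambda : Gate (Fin 3) where
  arity := 2
  coarity := 1
  map := fun x _ => if x 0 = 2 ∨ x 1 = 2 then 2 else x 0

def gateId : Gate (Fin 3) where
  arity := 1
  coarity := 1
  map := fun x _ => x 0

def gateCopy : Gate (Fin 3) where
  arity := 1
  coarity := 2
  map := fun x _ => x 0

/-- The gate set `𝓖_t` over the alphabet `{0,1,2}`. -/
def gatesT : Set (Gate (Fin 3)) := {gateAnd01, gateAnd2, gateLambda, gateId, gateCopy}

open Classical in
/-- `u → v` is an edge of the Boolean interaction graph of a network over `{0,1,2}`: the next state
of `v` effectively depends on that of `u` within the configurations in `{0,1}^V`. -/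
def Network.BoolEdge {V : Type} (F : Network (Fin 3) V) (u v : V) : Prop :=
  ∃ (x : V → Fin 3) (a : Fin 3), (∀ w, x w ≠ 2) ∧ a ≠ 2 ∧ F (Function.update x u a) v ≠ F x v

/-! ### Glueing and gadgets -/

/-- Node set of the glueing of two networks over the dowel `C₁ ⊕ C₂`. -/
abbrev GlueNodes {V₁ V₂ C₁ C₂ : Type} (φ₁ : C₁ ⊕ C₂ → V₁) (φ₂ : C₁ ⊕ C₂ → V₂) : Type :=
  (C₁ ⊕ C₂) ⊕ ({v : V₁ // v ∉ Set.range φ₁} ⊕ {v : V₂ // v ∉ Set.range φ₂})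

open Classical in
/-- The configuration of the first network read in a configuration of the glueing. -/
noncomputable def glueRestrict₁ {Q V₁ V₂ C₁ C₂ : Type} (φ₁ : C₁ ⊕ C₂ → V₁) (φ₂ : C₁ ⊕ C₂ → V₂)
    (x : GlueNodes φ₁ φ₂ → Q) : V₁ → Q :=
  fun v => if h : v ∈ Set.range φ₁ then x (.inl h.choose) else x (.inr (.inl ⟨v, h⟩))

open Classical in
/-- The configuration of the second network read in a configuration of the glueing. -/
noncomputable def glueRestrict₂ {Q V₁ V₂ C₁ C₂ : Type} (φ₁ : C₁ ⊕ C₂ → V₁) (φ₂ : C₁ ⊕ C₂ → V₂)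
    (x : GlueNodes φ₁ φ₂ → Q) : V₂ → Q :=
  fun v => if h : v ∈ Set.range φ₂ then x (.inl h.choose) else x (.inr (.inr ⟨v, h⟩))

/-- The glueing of two networks: nodes of `C₁` behave as in the first network, nodes of `C₂` as in
the second one. -/
noncomputable def glue {Q V₁ V₂ C₁ C₂ : Type} (F₁ : Network Q V₁) (F₂ : Network Q V₂)
    (φ₁ : C₁ ⊕ C₂ → V₁) (φ₂ : C₁ ⊕ C₂ → V₂) : Network Q (GlueNodes φ₁ φ₂) :=
  fun x v => match v with
    | .inl (.inl c) => F₁ (glueRestrict₁ φ₁ φ₂ x) (φ₁ (.inl c))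
    | .inl (.inr c) => F₂ (glueRestrict₂ φ₁ φ₂ x) (φ₂ (.inr c))
    | .inr (.inl v₁) => F₁ (glueRestrict₁ φ₁ φ₂ x) v₁.1
    | .inr (.inr v₂) => F₂ (glueRestrict₂ φ₁ φ₂ x) v₂.1

/-- A gadget with interface `C = Ci ⊕ Co`, input index set `I` and output index set `O`. -/
structure Gadget (Q Ci Co I O : Type) where
  V : Type
  finite : Finite V
  net : Network Q V
  inp : I → Ci ⊕ Co → V
  out : O → Ci ⊕ Co → V
  /-- all interface maps are injective and their images are pairwise disjoint -/
  injective : Function.Injective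
    (Sum.elim (fun p : I × (Ci ⊕ Co) => inp p.1 p.2) (fun p : O × (Ci ⊕ Co) => out p.1 p.2))

namespace Gadget

/-- The nodes that belong to a copy of the interface. -/
def IsInterface {Q Ci Co I O : Type} (X : Gadget Q Ci Co I O) (v : X.V) : Prop :=
  (∃ k c, X.inp k c = v) ∨ (∃ k c, X.out k c = v)

theorem inp_inj {Q Ci Co I O : Type} (X : Gadget Q Ci Co I O) {i j : I} {c d : Ci ⊕ Co}
    (h : X.inp i c = X.inp j d) : i = j ∧ c = d := by
  have := @X.injective (.inl (i, c)) (.inl (j, d)) h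
  simpa using this

theorem out_inj {Q Ci Co I O : Type} (X : Gadget Q Ci Co I O) {i j : O} {c d : Ci ⊕ Co}
    (h : X.out i c = X.out j d) : i = j ∧ c = d := by
  have := @X.injective (.inr (i, c)) (.inr (j, d)) h
  simpa using this

theorem inp_ne_out {Q Ci Co I O : Type} (X : Gadget Q Ci Co I O) (i : I) (j : O) (c d : Ci ⊕ Co) :
    X.inp i c ≠ X.out j d := by
  intro h
  have := @X.injective (.inl (i, c)) (.inr (j, d)) h
  simp at this

/-- The disjoint union of two gadgets. -/
def disjointUnion {Q Ci Co I J O P : Type} (X : Gadget Q Ci Co I O) (Y : Gadget Q Ci Co J P) :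
    Gadget Q Ci Co (I ⊕ J) (O ⊕ P) where
  V := X.V ⊕ Y.V
  finite := by
    have := X.finite
    have := Y.finite
    infer_instance
  net := fun x => Sum.elim (X.net (fun v => x (.inl v))) (Y.net (fun v => x (.inr v)))
  inp := fun k c => Sum.map (fun i => X.inp i c) (fun j => Y.inp j c) k
  out := fun k c => Sum.map (fun i => X.out i c) (fun j => Y.out j c) k
  injective := by
    rintro (⟨(i | i), c⟩ | ⟨(i | i), c⟩) (⟨(j | j), d⟩ | ⟨(j | j), d⟩) h <;>
      simp only [Sum.elim_inl, Sum.elim_inr, Sum.map_inl, Sum.map_inr, Sum.inl.injEq,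
        Sum.inr.injEq, reduceCtorEq] at h <;>
      first
        | exact absurd h (X.inp_ne_out _ _ _ _)
        | exact absurd h.symm (X.inp_ne_out _ _ _ _)
        | exact absurd h (Y.inp_ne_out _ _ _ _)
        | exact absurd h.symm (Y.inp_ne_out _ _ _ _)
        | (have := X.inp_inj h; simp_all)
        | (have := X.out_inj h; simp_all)
        | (have := Y.inp_inj h; simp_all)
        | (have := Y.out_inj h; simp_all)

/-- Embedding of the global dowel of a gadget glueing in the first gadget, whose inputs `σ a` and
outputs `τ b` are glued. The dowel is `C_X ⊕ C_Y` with `C_X = A × Ci ⊕ B × Co` and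
`C_Y = A × Co ⊕ B × Ci`. -/
def dowelFst {Q Ci Co I O A B : Type} (X : Gadget Q Ci Co I O) (σ : A → I) (τ : B → O) :
    (A × Ci ⊕ B × Co) ⊕ (A × Co ⊕ B × Ci) → X.V
  | .inl (.inl (a, c)) => X.inp (σ a) (.inl c)
  | .inl (.inr (b, c)) => X.out (τ b) (.inr c)
  | .inr (.inl (a, c)) => X.inp (σ a) (.inr c)
  | .inr (.inr (b, c)) => X.out (τ b) (.inl c)

/-- Embedding of the same dowel in the second gadget, whose outputs `σ a` and inputs `τ b` are
glued. -/
def dowelSnd {Q Ci Co J P A B : Type} (Y : Gadget Q Ci Co J P) (σ : A → P) (τ : B → J) :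
    (A × Ci ⊕ B × Co) ⊕ (A × Co ⊕ B × Ci) → Y.V
  | .inl (.inl (a, c)) => Y.out (σ a) (.inl c)
  | .inl (.inr (b, c)) => Y.inp (τ b) (.inr c)
  | .inr (.inl (a, c)) => Y.out (σ a) (.inr c)
  | .inr (.inr (b, c)) => Y.inp (τ b) (.inl c)

theorem inp_notMem_dowelFst {Q Ci Co I O A B : Type} (X : Gadget Q Ci Co I O) (σ : A → I)
    (τ : B → O) (i : {i : I // i ∉ Set.range σ}) (c : Ci ⊕ Co) :
    X.inp i.1 c ∉ Set.range (X.dowelFst σ τ) := by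
  rintro ⟨((⟨a, d⟩ | ⟨b, d⟩) | (⟨a, d⟩ | ⟨b, d⟩)), h⟩
  · exact i.2 ⟨a, (X.inp_inj h).1⟩
  · exact X.inp_ne_out _ _ _ _ h.symm
  · exact i.2 ⟨a, (X.inp_inj h).1⟩
  · exact X.inp_ne_out _ _ _ _ h.symm

theorem out_notMem_dowelFst {Q Ci Co I O A B : Type} (X : Gadget Q Ci Co I O) (σ : A → I)
    (τ : B → O) (i : {i : O // i ∉ Set.range τ}) (c : Ci ⊕ Co) :
    X.out i.1 c ∉ Set.range (X.dowelFst σ τ) := by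
  rintro ⟨((⟨a, d⟩ | ⟨b, d⟩) | (⟨a, d⟩ | ⟨b, d⟩)), h⟩
  · exact X.inp_ne_out _ _ _ _ h
  · exact i.2 ⟨b, (X.out_inj h).1⟩
  · exact X.inp_ne_out _ _ _ _ h
  · exact i.2 ⟨b, (X.out_inj h).1⟩

theorem inp_notMem_dowelSnd {Q Ci Co J P A B : Type} (Y : Gadget Q Ci Co J P) (σ : A → P)
    (τ : B → J) (i : {i : J // i ∉ Set.range τ}) (c : Ci ⊕ Co) :
    Y.inp i.1 c ∉ Set.range (Y.dowelSnd σ τ) := by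
  rintro ⟨((⟨a, d⟩ | ⟨b, d⟩) | (⟨a, d⟩ | ⟨b, d⟩)), h⟩
  · exact Y.inp_ne_out _ _ _ _ h.symm
  · exact i.2 ⟨b, (Y.inp_inj h).1⟩
  · exact Y.inp_ne_out _ _ _ _ h.symm
  · exact i.2 ⟨b, (Y.inp_inj h).1⟩

theorem out_notMem_dowelSnd {Q Ci Co J P A B : Type} (Y : Gadget Q Ci Co J P) (σ : A → P)
    (τ : B → J) (i : {i : P // i ∉ Set.range σ}) (c : Ci ⊕ Co) :
    Y.out i.1 c ∉ Set.range (Y.dowelSnd σ τ) := by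
  rintro ⟨((⟨a, d⟩ | ⟨b, d⟩) | (⟨a, d⟩ | ⟨b, d⟩)), h⟩
  · exact i.2 ⟨a, (Y.out_inj h).1⟩
  · exact Y.inp_ne_out _ _ _ _ h
  · exact i.2 ⟨a, (Y.out_inj h).1⟩
  · exact Y.inp_ne_out _ _ _ _ h

/-- Gadget glueing: for `a : A` the input `σX a` of `X` is glued on the output `σY a` of `Y`, and
for `b : B` the output `τX b` of `X` is glued on the input `τY b` of `Y`. -/
noncomputable def glueing {Q Ci Co I J O P A B : Type} (X : Gadget Q Ci Co I O)
    (Y : Gadget Q Ci Co J P) (σX : A ↪ I) (σY : A ↪ P) (τX : B ↪ O) (τY : B ↪ J) :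
    Gadget Q Ci Co
      ({i : I // i ∉ Set.range σX} ⊕ {j : J // j ∉ Set.range τY})
      ({o : O // o ∉ Set.range τX} ⊕ {p : P // p ∉ Set.range σY}) where
  V := GlueNodes (X.dowelFst σX τX) (Y.dowelSnd σY τY)
  finite := by
    have := X.finite
    have := Y.finite
    have hinj : Function.Injective (X.dowelFst σX τX) := by
      rintro ((⟨a, c⟩ | ⟨a, c⟩) | (⟨a, c⟩ | ⟨a, c⟩)) ((⟨b, d⟩ | ⟨b, d⟩) | (⟨b, d⟩ | ⟨b, d⟩)) h <;>
        simp only [dowelFst] at h <;>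
        first
          | exact absurd h (X.inp_ne_out _ _ _ _)
          | exact absurd h.symm (X.inp_ne_out _ _ _ _)
          | (have := X.inp_inj h; simp_all)
          | (have := X.out_inj h; simp_all)
    have := Finite.of_injective _ hinj
    infer_instance
  net := glue X.net Y.net (X.dowelFst σX τX) (Y.dowelSnd σY τY)
  inp := fun k c => match k with
    | .inl i => .inr (.inl ⟨X.inp i.1 c, X.inp_notMem_dowelFst _ _ i c⟩)
    | .inr j => .inr (.inr ⟨Y.inp j.1 c, Y.inp_notMem_dowelSnd _ _ j c⟩)
  out := fun k c => match k with
    | .inl o => .inr (.inl ⟨X.out o.1 c, X.out_notMem_dowelFst _ _ o c⟩)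
    | .inr p => .inr (.inr ⟨Y.out p.1 c, Y.out_notMem_dowelSnd _ _ p c⟩)
  injective := by
    rintro (⟨(i | i), c⟩ | ⟨(i | i), c⟩) (⟨(j | j), d⟩ | ⟨(j | j), d⟩) h <;>
      simp only [Sum.elim_inl, Sum.elim_inr, Sum.inl.injEq, Sum.inr.injEq, Subtype.mk.injEq,
        reduceCtorEq] at h <;>
      first
        | exact absurd h (X.inp_ne_out _ _ _ _)
        | exact absurd h.symm (X.inp_ne_out _ _ _ _)
        | exact absurd h (Y.inp_ne_out _ _ _ _)
        | exact absurd h.symm (Y.inp_ne_out _ _ _ _)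
        | (have := X.inp_inj h; simp_all [Subtype.ext_iff])
        | (have := X.out_inj h; simp_all [Subtype.ext_iff])
        | (have := Y.inp_inj h; simp_all [Subtype.ext_iff])
        | (have := Y.out_inj h; simp_all [Subtype.ext_iff])

end Gadget

/-- The closure by gadget glueing of a set of gadgets indexed by the gates of `𝓖`: the closure under
copies, disjoint unions and gadget glueings. -/
inductive GadgetClosure {Q R Ci Co : Type} {𝓖 : Set (Gate Q)}
    (X : ∀ g : 𝓖, Gadget R Ci Co (Fin g.1.arity) (Fin g.1.coarity)) :
    ∀ {I O : Type}, Gadget R Ci Co I O → Prop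
  | base (g : 𝓖) : GadgetClosure X (X g)
  | copy {I J O P : Type} {Y : Gadget R Ci Co I O} {Z : Gadget R Ci Co J P}
      (e : Y.V ≃ Z.V) (eI : I ≃ J) (eO : O ≃ P) (hnet : Y.net.rename e = Z.net)
      (hinp : ∀ k c, Z.inp (eI k) c = e (Y.inp k c))
      (hout : ∀ k c, Z.out (eO k) c = e (Y.out k c)) :
      GadgetClosure X Y → GadgetClosure X Z
  | disjointUnion {I J O P : Type} {Y : Gadget R Ci Co I O} {Z : Gadget R Ci Co J P} :
      GadgetClosure X Y → GadgetClosure X Z → GadgetClosure X (Y.disjointUnion Z)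
  | glueing {I J O P A B : Type} {Y : Gadget R Ci Co I O} {Z : Gadget R Ci Co J P}
      (σY : A ↪ I) (σZ : A ↪ P) (τY : B ↪ O) (τZ : B ↪ J) :
      GadgetClosure X Y → GadgetClosure X Z → GadgetClosure X (Y.glueing Z σY σZ τY τZ)

/-- `x` (restricted to the times `0, …, T`) is a `P`-pseudo-orbit of `F`. -/
def Network.IsPseudoOrbit {Q V : Type} (F : Network Q V) (P : Set V) (T : ℕ) (x : ℕ → V → Q) :
    Prop :=
  ∀ t < T, ∀ v ∉ P, x (t + 1) v = F (x t) v

/-- The family `𝓕` over the alphabet `R` has coherent `𝓖`-gadgets. -/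
def HasCoherentGadgets {Q R : Type} (𝓖 : Set (Gate Q)) (𝓕 : NetworkFamily R) : Prop :=
  ∃ (Ci Co : Type) (X : ∀ g : 𝓖, Gadget R Ci Co (Fin g.1.arity) (Fin g.1.coarity))
    (state : Q → Ci ⊕ Co → R)
    (context : ∀ g : 𝓖, {v : (X g).V // ¬ (X g).IsInterface v} → R)
    (T : ℕ) (trace : Q → Q → ℕ → Ci ⊕ Co → R),
    (∀ {I O : Type} (Y : Gadget R Ci Co I O), GadgetClosure X Y → 𝓕.Contains Y.net) ∧
    Function.Injective state ∧
    (∀ q q', trace q q' 0 = state q ∧ trace q q' T = state q') ∧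
    ∀ (g : 𝓖) (qi qi' : Fin g.1.arity → Q) (qo qo' : Fin g.1.coarity → Q), g.1.map qi = qo' →
      ∃ x : ℕ → (X g).V → R,
        (X g).net.IsPseudoOrbit
          ({v | ∃ k c, (X g).inp k (.inr c) = v} ∪ {v | ∃ k c, (X g).out k (.inl c) = v}) T x ∧
        (∀ t ≤ T, ∀ k c, x t ((X g).inp k c) = trace (qi k) (qi' k) t c) ∧
        (∀ t ≤ T, ∀ k c, x t ((X g).out k c) = trace (qo k) (qo' k) t c) ∧
        (∀ v, x 0 v.1 = context g v ∧ x T v.1 = context g v)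

/-! ### Simulation -/

/-- A block embedding of `Q^V` into `R^W`. The blocks `D_i = {w | block w = i}` partition `W`, and
`pattern w q` is the state at `w` of the pattern `p_{i,q}` of its block `i = block w`. -/
structure BlockEmbedding (Q V R W : Type) where
  block : W → V
  pattern : W → Q → R
  injective : ∀ i q q', (∀ w, block w = i → pattern w q = pattern w q') → q = q'

/-- The map `Q^V → R^W` defined by a block embedding. -/
def BlockEmbedding.toFun {Q V R W : Type} (φ : BlockEmbedding Q V R W) (x : V → Q) : W → R :=
  fun w => φ.pattern w (x (φ.block w))

/-- `G` simulates `F` via the block embedding `φ` with time constant `T`. -/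
def Simulates {Q V R W : Type} (G : Network R W) (F : Network Q V) (φ : BlockEmbedding Q V R W)
    (T : ℕ) : Prop :=
  ∀ x, φ.toFun (F x) = G^[T] (φ.toFun x)

/-! ### Boolean circuits -/

/-- A vertex of a Boolean circuit with `a` inputs, `j` vertices of which come before it. -/
inductive CircuitVertex (a j : ℕ) : Type
  | input (i : Fin a)
  | const (b : Bool)
  | not (u : Fin j)
  | and (u v : Fin j)
  | or (u v : Fin j)

/-- A Boolean circuit with `a` inputs and `b` outputs, its vertices in topological order. -/
structure Circuit (a b : ℕ) where
  size : ℕ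
  vertex : ∀ j : Fin size, CircuitVertex a j
  output : Fin b → Fin size

/-- The value of the vertex `j` on the input `x`. -/
def Circuit.value {a b : ℕ} (C : Circuit a b) (x : Fin a → Bool) (j : ℕ) (hj : j < C.size) :
    Bool :=
  match C.vertex ⟨j, hj⟩ with
  | .input i => x i
  | .const b => b
  | .not u => !(C.value x u.1 (lt_trans u.2 hj))
  | .and u v => C.value x u.1 (lt_trans u.2 hj) && C.value x v.1 (lt_trans v.2 hj)
  | .or u v => C.value x u.1 (lt_trans u.2 hj) || C.value x v.1 (lt_trans v.2 hj)
termination_by j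
decreasing_by
  all_goals first
    | exact u.2
    | exact v.2

def Circuit.eval {a b : ℕ} (C : Circuit a b) (x : Fin a → Bool) : Fin b → Bool :=
  fun i => C.value x (C.output i).1 (C.output i).2

/-- The Boolean coding of configurations: each state of `{0, …, q - 1}` is written on `q` bits, the
bit of its own index being the only one that is set. -/
def codeConfig {q n : ℕ} (x : Fin n → Fin q) : Fin (n * q) → Bool :=
  fun j => decide (x (finProdFinEquiv.symm j).1 = (finProdFinEquiv.symm j).2)

/-- `C` is a circuit encoding of the network `F`. -/
def Circuit.Encodes {q n : ℕ} (C : Circuit (n * q) (n * q)) (F : Network (Fin q) (Fin n)) : Prop :=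
  ∀ x, codeConfig (F x) = C.eval (codeConfig x)

/-! ### Words and representations -/

/-- The binary word of a list of numbers: each number `a` is written `1^a 0`. -/
def wordOfNats (l : List ℕ) : List Bool :=
  l.flatMap (fun a => List.replicate a true ++ [false])

def CircuitVertex.code {a j : ℕ} : CircuitVertex a j → List ℕ
  | .input i => [0, i.1, 0]
  | .const b => [1, b.toNat, 0]
  | .not u => [2, u.1, 0]
  | .and u v => [3, u.1, v.1]
  | .or u v => [4, u.1, v.1]

/-- The word that represents a circuit: numbers of inputs, outputs and vertices, then the list of
vertices with their predecessors, then the list of outputs. -/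
def Circuit.word {a b : ℕ} (C : Circuit a b) : List Bool :=
  wordOfNats ([a, b, C.size] ++ (List.ofFn (fun j => (C.vertex j).code)).flatten ++
    List.ofFn (fun i => (C.output i).1))

/-- A representation of a family over `{0, …, q - 1}` by words: `R w n F` says that `w` belongs to
the language and represents the member `F` with `n` nodes. -/
abbrev NetworkRepresentation (q : ℕ) : Type :=
  List Bool → ∀ n : ℕ, Network (Fin q) (Fin n) → Prop

/-- The networks with a circuit encoding of size at most `P n`, represented by these circuits. -/
def circuitRepresentation (q : ℕ) (P : Polynomial ℕ) : NetworkRepresentation q :=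
  fun w n F => ∃ C : Circuit (n * q) (n * q), C.size ≤ P.eval n ∧ C.Encodes F ∧ w = C.word

/-- A network given by a communication graph (the list of in-neighbours of each node) and local
transition tables. -/
structure LocalTables (q n : ℕ) where
  deg : Fin n → ℕ
  nbr : ∀ v, Fin (deg v) → Fin n
  nbr_injective : ∀ v, Function.Injective (nbr v)
  table : ∀ v, (Fin (deg v) → Fin q) → Fin q

def LocalTables.network {q n : ℕ} (L : LocalTables q n) : Network (Fin q) (Fin n) :=
  fun x v => L.table v (fun k => x (L.nbr v k))

/-- All in-degrees and out-degrees of the communication graph are at most `Δ`. -/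
def LocalTables.DegreeLE {q n : ℕ} (L : LocalTables q n) (Δ : ℕ) : Prop :=
  (∀ v, L.deg v ≤ Δ) ∧ ∀ u, Set.ncard {v | u ∈ Set.range (L.nbr v)} ≤ Δ

/-- The word that represents the graph and the transition tables. -/
def LocalTables.word {q n : ℕ} (L : LocalTables q n) : List Bool :=
  wordOfNats (n :: (List.ofFn (fun v =>
    L.deg v :: (List.ofFn (fun k => (L.nbr v k).1) ++
      List.ofFn (fun c : Fin (q ^ L.deg v) =>
        (L.table v (finFunctionFinEquiv.symm c)).1)))).flatten)

/-- The family of `𝓖`-networks with its bounded degree representation (degree bound `Δ`). -/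
def gateNetworkRepresentation {q : ℕ} (𝓖 : Set (Gate (Fin q))) (Δ : ℕ) : NetworkRepresentation q :=
  fun w n F => F ∈ gateNetworks 𝓖 n ∧
    ∃ L : LocalTables q n, L.network = F ∧ L.DegreeLE Δ ∧ w = L.word

/-! ### Logarithmic space transducers -/

inductive TapeSymbol : Type
  | leftEnd
  | rightEnd
  | bit (b : Bool)

inductive HeadMove : Type
  | left
  | stay
  | right

def HeadMove.apply : HeadMove → ℕ → ℕ
  | .left, p => p - 1
  | .stay, p => p
  | .right, p => p + 1

/-- A deterministic Turing machine with a read-only two-way input tape with end markers, a work tape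
and a write-only one-way output tape. State `0` is initial, work symbol `0` is the blank. The
transition yields the new state, the symbol written on the work tape, the moves of the input head
and of the work head, and possibly a bit appended to the output; it is `none` when the machine
halts. -/
structure Transducer where
  numStates : ℕ
  numSymbols : ℕ
  transition : Fin (numStates + 1) → TapeSymbol → Fin (numSymbols + 1) →
    Option (Fin (numStates + 1) × Fin (numSymbols + 1) × HeadMove × HeadMove × Option Bool)

namespace Transducer

structure Config (M : Transducer) where
  state : Fin (M.numStates + 1)
  inputPos : ℕ
  work : ℕ → Fin (M.numSymbols + 1)
  workPos : ℕ
  output : List Bool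

def start (M : Transducer) : M.Config where
  state := 0
  inputPos := 0
  work := fun _ => 0
  workPos := 0
  output := []

/-- Content of cell `p` of the input tape: cell `0` holds the left marker, then comes the word. -/
def readInput (w : List Bool) (p : ℕ) : TapeSymbol :=
  if p = 0 then .leftEnd else
    match w[p - 1]? with
    | some b => .bit b
    | none => .rightEnd

def next (M : Transducer) (w : List Bool) (c : M.Config) : Option M.Config :=
  (M.transition c.state (readInput w c.inputPos) (c.work c.workPos)).map
    fun r =>
      { state := r.1
        inputPos := min (r.2.2.1.apply c.inputPos) (w.length + 1)
        work := Function.update c.work c.workPos r.2.1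
        workPos := r.2.2.2.1.apply c.workPos
        output := c.output ++ r.2.2.2.2.toList }

/-- `c` is reached by the machine in its run on `w`. -/
def Reaches (M : Transducer) (w : List Bool) (c : M.Config) : Prop :=
  Relation.ReflTransGen (fun c₁ c₂ => M.next w c₁ = some c₂) M.start c

/-- On the input `w` the machine halts with output `w'`. -/
def Computes (M : Transducer) (w w' : List Bool) : Prop :=
  ∃ c, M.Reaches w c ∧ M.next w c = none ∧ c.output = w'

/-- The machine halts on every input `w` and visits `O(log |w|)` cells of its work tape. -/
def IsLogspace (M : Transducer) : Prop :=
  (∀ w, ∃ w', M.Computes w w') ∧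
    ∃ k : ℕ, ∀ w c, M.Reaches w c → c.workPos ≤ k * (Nat.log 2 w.length + 1)

end Transducer

/-! ### Simulation between families and universality -/

/-- The word for a triple: a word, a time constant, and a block embedding given by its list of blocks
and its list of patterns. -/
def simulationWord {q n r m : ℕ} (w : List Bool) (T : ℕ)
    (φ : BlockEmbedding (Fin q) (Fin n) (Fin r) (Fin m)) : List Bool :=
  wordOfNats [w.length] ++ w ++ wordOfNats (T :: (List.ofFn (fun v => (φ.block v).1) ++
    (List.ofFn (fun v => List.ofFn (fun a => (φ.pattern v a).1))).flatten))

/-- The family represented by `𝓐` simulates the family represented by `𝓑` in time `T` and space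
`S`. -/
def NetworkRepresentation.SimulatesFamily {r q : ℕ} (𝓐 : NetworkRepresentation r) (𝓑 : NetworkRepresentation q)
    (T S : ℕ → ℕ) : Prop :=
  ∃ M : Transducer, M.IsLogspace ∧
    ∀ (w : List Bool) (n : ℕ) (H : Network (Fin q) (Fin n)), 𝓑 w n H →
      ∃ (w' : List Bool) (F : Network (Fin r) (Fin (S n)))
        (φ : BlockEmbedding (Fin q) (Fin n) (Fin r) (Fin (S n))),
        M.Computes w (simulationWord w' (T n) φ) ∧ 𝓐 w' (S n) F ∧ Simulates F H φ (T n)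

def PolynomiallyBounded (f : ℕ → ℕ) : Prop :=
  ∃ P : Polynomial ℕ, ∀ n, f n ≤ P.eval n

/-- Universality: for every alphabet and every polynomial `P`, the family simulates, in polynomial
time and space, the family of all networks with circuit encodings of size at most `P`. -/
def NetworkRepresentation.IsUniversal {r : ℕ} (𝓐 : NetworkRepresentation r) : Prop :=
  ∀ q : ℕ, 0 < q → ∀ P : Polynomial ℕ, ∃ T S : ℕ → ℕ,
    PolynomiallyBounded T ∧ PolynomiallyBounded S ∧
      𝓐.SimulatesFamily (circuitRepresentation q P) T S

/-- The weakening of universality where nothing is asked about how the simulating network is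
computed: each network with `n` nodes and a circuit encoding of size at most `P n` is simulated by
some member of the family with polynomially many nodes and in polynomial time. -/
def NetworkFamily.IsNonuniformlyUniversal {R : Type} (𝓕 : NetworkFamily R) : Prop :=
  ∀ q : ℕ, 0 < q → ∀ P : Polynomial ℕ, ∃ T S : ℕ → ℕ,
    PolynomiallyBounded T ∧ PolynomiallyBounded S ∧
      ∀ (n : ℕ) (H : Network (Fin q) (Fin n)) (C : Circuit (n * q) (n * q)),
        C.size ≤ P.eval n → C.Encodes H →
          ∃ m ≤ S n, ∃ F ∈ 𝓕 m, ∃ (φ : BlockEmbedding (Fin q) (Fin n) R (Fin m)), ∃ t ≤ T n,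
            Simulates F H φ t

/-! ### Closed walks and periodic sequences -/

/-! The state 2 spreads through every gate, and for the order 1 < 0 < 2 no gate output lies below an
input on which it depends within {0,1}. Following a cycle of length p ≤ n through v, the trace of v
(for a Boolean cycle) or its indicator of 2 (for any cycle) does not decrease when time advances by
p. On a periodic orbit it is then p-periodic (`exists_period_of_cycle`). The only dependency that is
not Boolean is the second input of Λ, which matters only through being 2 or not. The remaining nodes
are therefore handled by induction along an acyclic relation, and every period of a network with m
nodes divides lcm(1, …, m) (`Wiring.iterate_lcmUpto`).

This excludes universality. The binary counter on n bits has a circuit of size 8n and an orbit of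
period 2^n, and a simulation carries the divisibility over. The exponent of 2 in lcm(1, …, m) is
only log₂ m, so a simulating network needs m ≥ 2^n nodes.

The same lcm produces long transients. Cycles of lengths 2, …, k + 1 serve as clocks and cost O(k²)
nodes. A chain of conjunctions detects their coincidence, which first happens near time lcm(1, …, k
+ 1) ≥ 2^(k+1) / (k + 2). AND₂ then emits a 2, which enters through the second input of Λ a loop
that held 1, and never leaves it. No earlier configuration can recur
(`Clock.config_notMem_periodicPts`).

For coherent gadgets, the pseudo-orbits of the gates of a wiring agree on shared interfaces because
both sides follow the same trace. Glued along the whole wiring they become true orbits, which gives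
an injective simulation in constant time and linear size (`HasCoherentGadgets.exists_simulation`).
Injectivity carries non-periodicity over to the simulating network. -/

/-- A closed walk of a relation on a finite type can be chosen no longer than the number of
vertices. -/
theorem exists_short_closed_walk {V : Type} [Fintype V] {r : V → V → Prop} {v : V}
    (h : Relation.TransGen r v v) :
    ∃ p, 0 < p ∧ p ≤ Fintype.card V ∧
      ∃ c : ℕ → V, c 0 = v ∧ c p = v ∧ ∀ i < p, r (c i) (c (i + 1)) := by
  classical
  have hex : ∃ p, 0 < p ∧ ∃ c : ℕ → V, c 0 = v ∧ c p = v ∧ ∀ i < p, r (c i) (c (i + 1)) := by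
    have key : ∀ w, Relation.TransGen r v w →
        ∃ p, 0 < p ∧ ∃ c : ℕ → V, c 0 = v ∧ c p = w ∧ ∀ i < p, r (c i) (c (i + 1)) := by
      intro w hw
      induction hw with
      | single hr =>
        rename_i b
        refine ⟨1, one_pos, fun i => if i = 0 then v else b, by simp, by simp, ?_⟩
        intro i hi
        obtain rfl : i = 0 := by omega
        simpa using hr
      | tail _ hr ih =>
        rename_i b d _
        obtain ⟨p, hp, c, h0, h1, hc⟩ := ih
        refine ⟨p + 1, by omega, fun i => if i ≤ p then c i else d, by simp [h0], by simp, ?_⟩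
        intro i hi
        rcases Nat.lt_or_ge i p with hip | hip
        · simpa [hip.le, Nat.succ_le_of_lt hip] using hc i hip
        · obtain rfl : i = p := by omega
          simpa [h1] using hr
    exact key v h
  refine ⟨Nat.find hex, (Nat.find_spec hex).1, ?_, (Nat.find_spec hex).2⟩
  -- In a closed walk of minimal length exceeding the number of vertices, two of the first p
  -- vertices coincide; cutting out the segment between them keeps the walk closed at v and shortens
  -- it.
  by_contra! hlt
  obtain ⟨hp, c, h0, h1, hc⟩ := Nat.find_spec hex
  set p := Nat.find hex with hpdef
  obtain ⟨i, j, hij, hcij⟩ : ∃ i j : Fin p, i < j ∧ c i = c j := by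
    obtain ⟨i, j, hne, he⟩ := Fintype.exists_ne_map_eq_of_card_lt (fun i : Fin p => c i)
      (by simpa using hlt)
    rcases lt_or_gt_of_ne hne with h | h
    · exact ⟨i, j, h, he⟩
    · exact ⟨j, i, h, he.symm⟩
  have hij' : (i : ℕ) < j := hij
  have hjp : (j : ℕ) < p := j.2
  refine Nat.find_min hex (m := p - (j - i)) (by omega) ⟨by omega,
    fun s => if s ≤ i then c s else c (s + (j - i)), by simp [h0], ?_, ?_⟩
  · have h2 : ¬ p - ((j : ℕ) - i) ≤ i := by omega
    have h3 : p - ((j : ℕ) - i) + (j - i) = p := by omega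
    simp only [h2, if_false, h3, h1]
  · intro s hs
    rcases lt_trichotomy s (i : ℕ) with hsi | hsi | hsi
    · have h2 : s + 1 ≤ i := hsi
      simpa only [hsi.le, h2, if_true] using hc s (by omega)
    · subst hsi
      have h2 : ¬ (i : ℕ) + 1 ≤ i := by omega
      have h3 : (i : ℕ) + 1 + (j - i) = j + 1 := by omega
      simpa only [le_refl, if_true, h2, if_false, h3, hcij] using hc j (by omega)
    · have h2 : ¬ s ≤ i := by omega
      have h3 : ¬ s + 1 ≤ i := by omega
      have h4 : s + 1 + ((j : ℕ) - i) = s + (j - i) + 1 := by omega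
      simpa only [h2, h3, if_false, h4] using hc (s + (j - i)) (by omega)

/-- A periodic sequence that does not decrease along steps of length `p` has period `p`. -/
theorem eq_of_periodic_of_le_shift {α : Type} [PartialOrder α] {f : ℕ → α} {N p : ℕ} (hN : 0 < N)
    (hper : ∀ t, f (t + N) = f t) (hle : ∀ t, f t ≤ f (t + p)) (t : ℕ) : f (t + p) = f t := by
  have hmul : ∀ k s, f (s + k * N) = f s := by
    intro k
    induction k with
    | zero => simp
    | succ k ih => intro s; rw [Nat.succ_mul, ← add_assoc, hper, ih]
  have hmono : ∀ k s, f s ≤ f (s + k * p) := by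
    intro k
    induction k with
    | zero => simp
    | succ k ih => intro s; rw [Nat.succ_mul, ← add_assoc]; exact (ih s).trans (hle _)
  refine le_antisymm ?_ (hle t)
  have h := hmono (N - 1) (t + p)
  -- Another N - 1 shifts by p lead from t + p to t + pN, where the value at t recurs; so f (t + p)
  -- ≤ f t.
  have h2 : t + p + (N - 1) * p = t + p * N := by
    obtain ⟨M, rfl⟩ : ∃ M, N = M + 1 := ⟨N - 1, by omega⟩
    simp only [Nat.add_sub_cancel]; ring
  rwa [h2, hmul] at h

theorem iterate_add_period {α : Type} {F : α → α} {x : α} {N : ℕ} (h : F^[N] x = x) (t : ℕ) :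
    F^[t + N] x = F^[t] x := by
  rw [Function.iterate_add_apply, h]

/-! ### Dependencies of gates -/

/-- The output `o` of `g` effectively depends on its input `k` within the tuples over `{0,1}`. -/
def Gate.BoolDep (g : Gate (Fin 3)) (k : Fin g.arity) (o : Fin g.coarity) : Prop :=
  ∃ (y : Fin g.arity → Fin 3) (a : Fin 3), (∀ i, y i ≠ 2) ∧ a ≠ 2 ∧
    g.map (Function.update y k a) o ≠ g.map y o

/-- The states ordered by `1 < 0 < 2`: on this order the gates of `gatesT` are nondecreasing along
their Boolean dependencies. -/
def stateRank (a : Fin 3) : ℕ := if a = 2 then 2 else if a = 0 then 1 else 0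

theorem stateRank_injective : Function.Injective stateRank := by
  intro a b
  revert a b
  decide

theorem gatesT_two_spreads {g : Gate (Fin 3)} (hg : g ∈ gatesT) (y : Fin g.arity → Fin 3)
    (k : Fin g.arity) (o : Fin g.coarity) (h : y k = 2) : g.map y o = 2 := by
  simp only [gatesT, Set.mem_insert_iff, Set.mem_singleton_iff] at hg
  rcases hg with rfl | rfl | rfl | rfl | rfl <;> revert h <;> revert y k o <;>
    simp only [gateAnd01, gateAnd2, gateLambda, gateId, gateCopy] <;> decide

/-- A 2 is absorbing, and an input 0 on which a gate depends over {0,1} excludes the output 1. The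
dependency is essential: Λ returns 1 on (1, 0), but its second input is not a Boolean dependency. -/
theorem gatesT_rank_le {g : Gate (Fin 3)} (hg : g ∈ gatesT) (k : Fin g.arity) (o : Fin g.coarity)
    (hd : g.BoolDep k o) (y : Fin g.arity → Fin 3) : stateRank (y k) ≤ stateRank (g.map y o) := by
  unfold Gate.BoolDep at hd
  simp only [gatesT, Set.mem_insert_iff, Set.mem_singleton_iff] at hg
  rcases hg with rfl | rfl | rfl | rfl | rfl <;> revert hd <;> revert y k o <;>
    simp only [gateAnd01, gateAnd2, gateLambda, gateId, gateCopy] <;> decide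

/-- Every input of every gate is a Boolean dependency except the second input of Λ, of which only
the property of being 2 is used. -/
theorem gatesT_map_congr {g : Gate (Fin 3)} (hg : g ∈ gatesT) (o : Fin g.coarity)
    (y y' : Fin g.arity → Fin 3) (h2 : ∀ k, y k = 2 ↔ y' k = 2)
    (hd : ∀ k, g.BoolDep k o → y k = y' k) : g.map y o = g.map y' o := by
  have hall : (∀ k, g.BoolDep k o) → g.map y o = g.map y' o := fun h => by
    rw [funext fun k => hd k (h k)]
  simp only [gatesT, Set.mem_insert_iff, Set.mem_singleton_iff] at hg
  rcases hg with rfl | rfl | rfl | rfl | rfl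
  · exact hall (by clear hall hd h2; revert o; unfold Gate.BoolDep; simp only [gateAnd01]; decide)
  · exact hall (by clear hall hd h2; revert o; unfold Gate.BoolDep; simp only [gateAnd2]; decide)
  · have h0 : y (0 : Fin 2) = y' (0 : Fin 2) :=
      hd (0 : Fin 2) (by clear hall hd h2; revert o; unfold Gate.BoolDep; simp only [gateLambda]; decide)
    have h1 := h2 (1 : Fin 2)
    simp only [gateLambda] at h1 ⊢
    simp only [h0, h1]
  · exact hall (by clear hall hd h2; revert o; unfold Gate.BoolDep; simp only [gateId]; decide)
  · exact hall (by clear hall hd h2; revert o; unfold Gate.BoolDep; simp only [gateCopy]; decide)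

theorem gatesT_map_zero_ne_two {g : Gate (Fin 3)} (hg : g ∈ gatesT) (o : Fin g.coarity) :
    g.map (fun _ => 0) o ≠ 2 := by
  simp only [gatesT, Set.mem_insert_iff, Set.mem_singleton_iff] at hg
  rcases hg with rfl | rfl | rfl | rfl | rfl <;> revert o <;>
    simp only [gateAnd01, gateAnd2, gateLambda, gateId, gateCopy] <;> decide

/-! ### Interaction graphs of networks of gates -/

namespace Wiring

variable {V : Type} (W : Wiring gatesT V)

theorem network_apply {Q : Type} {𝓖 : Set (Gate Q)} (W : Wiring 𝓖 V) (x : V → Q) (v : V) :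
    W.network x v = (W.gate (W.outputs v).1).map
      (fun k => x (W.inputs ⟨(W.outputs v).1, k⟩)) (W.outputs v).2 := rfl

open Classical in
theorem read_update {Q : Type} {𝓖 : Set (Gate Q)} (W : Wiring 𝓖 V) (x : V → Q) (j : Fin W.numGates)
    (k : Fin (W.gate j).arity) (a : Q) :
    (fun i => Function.update x (W.inputs ⟨j, k⟩) a (W.inputs ⟨j, i⟩)) =
      Function.update (fun i => x (W.inputs ⟨j, i⟩)) k a := by
  funext i
  by_cases h : i = k
  · subst h; simp
  · have : W.inputs ⟨j, i⟩ ≠ W.inputs ⟨j, k⟩ := by simpa using h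
    simp [h]

theorem exists_input_of_edge {Q : Type} {𝓖 : Set (Gate Q)} (W : Wiring 𝓖 V) {u v : V}
    (h : W.network.Edge u v) : ∃ k, W.inputs ⟨(W.outputs v).1, k⟩ = u := by
  classical
  obtain ⟨x, a, hne⟩ := h
  by_contra! hk
  refine hne ?_
  rw [network_apply, network_apply]
  congr 1
  funext k
  exact Function.update_of_ne (hk k) _ _

/-- Changing one input of the all-zero configuration to 2 makes the output 2, which it was not
before. So interaction edges are exactly the wires into a gate. -/
theorem edge_input (v : V) (k : Fin (W.gate (W.outputs v).1).arity) :
    W.network.Edge (W.inputs ⟨(W.outputs v).1, k⟩) v := by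
  refine ⟨fun _ => 0, 2, ?_⟩
  rw [network_apply, network_apply, read_update,
    gatesT_two_spreads (W.gate_mem _) _ k _ (Function.update_self ..)]
  exact (gatesT_map_zero_ne_two (W.gate_mem _) _).symm

theorem boolEdge_input (v : V) (k : Fin (W.gate (W.outputs v).1).arity)
    (h : (W.gate (W.outputs v).1).BoolDep k (W.outputs v).2) :
    W.network.BoolEdge (W.inputs ⟨(W.outputs v).1, k⟩) v := by
  classical
  obtain ⟨y, a, hy, ha, hne⟩ := h
  let j := (W.outputs v).1
  -- The tuple y is placed on the nodes read by the gate; elsewhere any state other than 2 would do.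
  let x : V → Fin 3 := fun w => if h : ∃ i, W.inputs ⟨j, i⟩ = w then y h.choose else 0
  have hx : (fun i => x (W.inputs ⟨j, i⟩)) = y := by
    funext i
    have h : ∃ i', W.inputs ⟨j, i'⟩ = W.inputs ⟨j, i⟩ := ⟨i, rfl⟩
    have hi : h.choose = i := by simpa only [EmbeddingLike.apply_eq_iff_eq, Sigma.mk.injEq, heq_eq_eq, true_and] using
      h.choose_spec
    simp only [x, dif_pos h, hi]
  refine ⟨x, a, ?_, ha, ?_⟩
  · intro w
    simp only [x]
    split_ifs
    · exact hy _
    · decide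
  · rw [network_apply, network_apply, read_update, hx]
    exact hne

theorem boolDep_of_boolEdge {u v : V} (h : W.network.BoolEdge u v) :
    ∃ k, W.inputs ⟨(W.outputs v).1, k⟩ = u ∧
      (W.gate (W.outputs v).1).BoolDep k (W.outputs v).2 := by
  obtain ⟨x, a, hx, ha, hne⟩ := h
  obtain ⟨k, rfl⟩ := W.exists_input_of_edge ⟨x, a, hne⟩
  refine ⟨k, rfl, fun i => x (W.inputs ⟨(W.outputs v).1, i⟩), a, fun i => hx _, ha, ?_⟩
  rwa [network_apply, network_apply, read_update] at hne

theorem two_of_edge {u v : V} (h : W.network.Edge u v) (x : V → Fin 3) (hu : x u = 2) :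
    W.network x v = 2 := by
  obtain ⟨k, rfl⟩ := W.exists_input_of_edge h
  exact gatesT_two_spreads (W.gate_mem _) _ k _ hu

theorem rank_le_of_boolEdge {u v : V} (h : W.network.BoolEdge u v) (x : V → Fin 3) :
    stateRank (x u) ≤ stateRank (W.network x v) := by
  obtain ⟨k, rfl, hk⟩ := W.boolDep_of_boolEdge h
  exact gatesT_rank_le (W.gate_mem _) k _ hk
    (fun i => x (W.inputs ⟨(W.outputs v).1, i⟩))

/-- This is what makes the two kinds of period combine: a non-Boolean in-neighbour only has to be
known up to its indicator of 2. -/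
theorem network_congr {v : V} {x y : V → Fin 3}
    (h2 : ∀ u, W.network.Edge u v → (x u = 2 ↔ y u = 2))
    (hb : ∀ u, W.network.BoolEdge u v → x u = y u) : W.network x v = W.network y v :=
  gatesT_map_congr (W.gate_mem _) _ _ _ (fun k => h2 _ (W.edge_input v k))
    (fun k hk => hb _ (W.boolEdge_input v k hk))

theorem not_edge_self {Q : Type} {𝓖 : Set (Gate Q)} (W : Wiring 𝓖 V) (v : V) :
    ¬ W.network.Edge v v := by
  intro h
  obtain ⟨k, hk⟩ := W.exists_input_of_edge h
  exact W.no_self_loop ⟨_, k⟩ (by rw [hk])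

end Wiring

theorem Network.BoolEdge.edge {V : Type} {F : Network (Fin 3) V} {u v : V} (h : F.BoolEdge u v) :
    F.Edge u v := by
  obtain ⟨x, a, -, -, hne⟩ := h
  exact ⟨x, a, hne⟩

/-- A quantity that does not decrease along the edges of a relation `r` has, on a periodic orbit and
at a vertex of a cycle of `r`, a period at most the number of vertices. -/
theorem exists_period_of_cycle {Q V : Type} [Fintype V] {F : Network Q V} {r : V → V → Prop}
    {ρ : Q → ℕ} (hρ : ∀ u v, r u v → ∀ x, ρ (x u) ≤ ρ (F x v)) {x : V → Q}
    (hx : x ∈ Function.periodicPts F) {v : V} (hv : Relation.TransGen r v v) :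
    ∃ p, 0 < p ∧ p ≤ Fintype.card V ∧ ∀ t, ρ (F^[t + p] x v) = ρ (F^[t] x v) := by
  obtain ⟨p, hp, hpn, c, h0, h1, hc⟩ := exists_short_closed_walk hv
  obtain ⟨N, hN, hper⟩ := hx
  refine ⟨p, hp, hpn, eq_of_periodic_of_le_shift (f := fun t => ρ (F^[t] x v)) hN ?_ ?_⟩
  · intro t
    simp only [iterate_add_period hper.eq]
  · intro t
    -- The value is followed around the cycle, one edge per time step.
    have key : ∀ i ≤ p, ρ (F^[t] x v) ≤ ρ (F^[t + i] x (c i)) := by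
      intro i
      induction i with
      | zero => simp [h0]
      | succ i ih =>
        intro hi
        refine (ih (by omega)).trans ?_
        rw [← add_assoc, Function.iterate_succ_apply']
        exact hρ _ _ (hc i hi) _
    simpa [h1] using key p le_rfl

namespace Wiring

variable {V : Type} [Fintype V] (W : Wiring gatesT V)

theorem exists_two_period {x : V → Fin 3} (hx : x ∈ Function.periodicPts W.network) {v : V}
    (hv : Relation.TransGen W.network.Edge v v) :
    ∃ p, 0 < p ∧ p ≤ Fintype.card V ∧
      ∀ t, W.network^[t + p] x v = 2 ↔ W.network^[t] x v = 2 := by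
  obtain ⟨p, hp, hpn, h⟩ := exists_period_of_cycle (F := W.network) (r := W.network.Edge)
    -- The indicator of 2 does not decrease along edges, since 2 spreads.
    (ρ := fun a => if a = 2 then 1 else 0) (fun u w huw y => by
      by_cases h : y u = 2
      · simp [h, W.two_of_edge huw y h]
      · simp [h]) hx hv
  refine ⟨p, hp, hpn, fun t => ?_⟩
  have := h t
  by_cases h1 : W.network^[t + p] x v = 2 <;> by_cases h2 : W.network^[t] x v = 2 <;>
    simp_all

theorem exists_period {x : V → Fin 3} (hx : x ∈ Function.periodicPts W.network) {v : V}
    (hv : Relation.TransGen W.network.BoolEdge v v) :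
    ∃ p, 0 < p ∧ p ≤ Fintype.card V ∧ ∀ t, W.network^[t + p] x v = W.network^[t] x v := by
  obtain ⟨p, hp, hpn, h⟩ := exists_period_of_cycle (r := W.network.BoolEdge) (ρ := stateRank)
    (fun u w huw y => W.rank_le_of_boolEdge huw y) hx hv
  exact ⟨p, hp, hpn, fun t => stateRank_injective (h t)⟩

theorem two_le_card_of_edge {u v : V} (h : W.network.Edge u v) : 2 ≤ Fintype.card V := by
  have : Nontrivial V := ⟨u, v, fun huv => W.not_edge_self v (huv ▸ h)⟩
  exact Fintype.one_lt_card

end Wiring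

/-- Traces of periodic configurations at nodes of strongly connected components. -/
theorem gateNetworks_gatesT_traces (n : ℕ) (F : Network (Fin 3) (Fin n))
    (hF : F ∈ gateNetworks gatesT n) (x : Fin n → Fin 3) (hx : x ∈ Function.periodicPts F)
    (v : Fin n) :
    (Relation.TransGen F.Edge v v →
      ∃ p : ℕ, 0 < p ∧ p ≤ n ∧ ∀ t : ℕ, F^[t + p] x v = 2 ↔ F^[t] x v = 2) ∧
    (Relation.TransGen F.BoolEdge v v →
      ∃ p : ℕ, 0 < p ∧ p ≤ n ∧ p < n ^ 2 ∧ ∀ t : ℕ, F^[t + p] x v = F^[t] x v) := by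
  obtain ⟨W, rfl⟩ := hF
  refine ⟨fun hv => ?_, fun hv => ?_⟩
  · simpa using W.exists_two_period hx hv
  · obtain ⟨p, hp, hpn, h⟩ := W.exists_period hx hv
    have h2 : 2 ≤ n := by
      obtain ⟨u, -, hu⟩ := Relation.TransGen.tail'_iff.1 hv
      simpa using W.two_le_card_of_edge hu.edge
    simp only [Fintype.card_fin] at hpn
    exact ⟨p, hp, hpn, by nlinarith, h⟩

/-! ### Periods of networks of gates -/

theorem mul_period_eq {α : Type} {f : ℕ → α} {p : ℕ} (h : ∀ t, f (t + p) = f t) (k t : ℕ) :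
    f (t + p * k) = f t := by
  induction k with
  | zero => simp
  | succ k ih => rw [Nat.mul_succ, ← add_assoc, h, ih]

theorem dvd_lcmUpto {p n : ℕ} (hp : 0 < p) (hpn : p ≤ n) : p ∣ Nat.lcmUpto n :=
  Finset.dvd_lcm (f := id) (Finset.mem_Icc.2 ⟨hp, hpn⟩)

/-- On a Boolean cycle the whole trace, and on any cycle the indicator of 2, has a period at most
the number of nodes, which divides the lcm. The states of the other nodes follow by well-founded
induction on the information that their update still requires. -/
theorem Wiring.iterate_lcmUpto {V : Type} [Fintype V] (W : Wiring gatesT V) {x : V → Fin 3}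
    (hx : x ∈ Function.periodicPts W.network) :
    W.network^[Nat.lcmUpto (Fintype.card V)] x = x := by
  set F := W.network
  set L := Nat.lcmUpto (Fintype.card V)
  have hE : ∀ u, Relation.TransGen F.Edge u u → ∀ t, F^[t + L] x u = 2 ↔ F^[t] x u = 2 := by
    intro u hu t
    obtain ⟨p, hp, hpn, h⟩ := W.exists_two_period hx hu
    obtain ⟨k, hk⟩ := dvd_lcmUpto hp hpn
    have := mul_period_eq (f := fun t => F^[t] x u = 2) (fun t => propext (h t)) k t
    rw [← hk] at this
    exact this.to_iff
  have hB : ∀ u, Relation.TransGen F.BoolEdge u u → ∀ t, F^[t + L] x u = F^[t] x u := by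
    intro u hu t
    obtain ⟨p, hp, hpn, h⟩ := W.exists_period hx hu
    obtain ⟨k, hk⟩ := dvd_lcmUpto hp hpn
    have := mul_period_eq (f := fun t => F^[t] x u) h k t
    rwa [← hk] at this
  -- `r u v` means that the induction at v needs the exact state of u: v is not settled by a Boolean
  -- cycle, and u is a Boolean in-neighbour or its indicator of 2 is not settled by a cycle.
  let r : V → V → Prop := fun u v =>
    (F.BoolEdge u v ∨ F.Edge u v ∧ ¬ Relation.TransGen F.Edge u u) ∧
      ¬ Relation.TransGen F.BoolEdge v v
  have hr : ∀ u v, r u v → F.Edge u v := fun u v h => h.1.elim (·.edge) (·.1)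
  have hrb : ∀ u v, r u v → Relation.ReflTransGen F.Edge v u → F.BoolEdge u v := by
    intro u v h hvu
    exact h.1.resolve_right fun h' => h'.2 (Relation.TransGen.head' h'.1 hvu)
  -- On a closed walk of `r` every source lies on a cycle of the interaction graph, so every edge
  -- must be Boolean. The walk is then a Boolean cycle, which the second clause of `r` forbids at
  -- its nodes.
  have hcyc : ∀ u v, Relation.TransGen r u v → Relation.ReflTransGen F.Edge v u →
      Relation.TransGen F.BoolEdge u v := by
    intro u v h
    induction h with
    | single h => exact fun hvu => .single (hrb _ _ h hvu)
    | tail h1 h2 ih =>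
      intro hcu
      have h3 : Relation.ReflTransGen F.Edge u _ := (Relation.TransGen.mono hr _ _ h1).to_reflTransGen
      exact .tail (ih (.head (hr _ _ h2) hcu)) (hrb _ _ h2 (hcu.trans h3))
  have hirr : ∀ v, ¬ Relation.TransGen r v v := by
    intro v h
    obtain ⟨u, -, hu⟩ := Relation.TransGen.tail'_iff.1 h
    exact hu.2 (hcyc v v h .refl)
  have : Std.Irrefl (Relation.TransGen r) := ⟨hirr⟩
  have hwf : WellFounded (Relation.TransGen r) := Finite.wellFounded_of_trans_of_irrefl _
  have key : ∀ v, ∀ t, F^[t + L] x v = F^[t] x v := by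
    intro v
    induction v using hwf.induction with
    | _ v ih =>
      by_cases hv : Relation.TransGen F.BoolEdge v v
      · exact hB v hv
      have hsucc : ∀ t, F^[t + 1 + L] x v = F^[t + 1] x v := by
        intro t
        rw [show t + 1 + L = t + L + 1 by omega, Function.iterate_succ_apply',
          Function.iterate_succ_apply']
        refine W.network_congr (fun u hu => ?_) (fun u hu => ?_)
        · by_cases hc : Relation.TransGen F.Edge u u
          · exact hE u hc t
          · rw [ih u (.single ⟨.inr ⟨hu, hc⟩, hv⟩) t]
        · exact ih u (.single ⟨.inl hu, hv⟩) t
      -- The update rule only reaches times at least 1; time t is recovered as the positive time t +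
      -- N.
      obtain ⟨N, hN, hper⟩ := hx
      intro t
      have h := hsucc (t + N - 1)
      rwa [show t + N - 1 + 1 = t + N by omega, show t + N + L = t + L + N by omega,
        iterate_add_period hper.eq, iterate_add_period hper.eq] at h
  funext v
  simpa using key v 0

/-! ### Simulations -/

theorem BlockEmbedding.toFun_injective {Q V R W : Type} (φ : BlockEmbedding Q V R W) :
    Function.Injective φ.toFun := by
  intro x y h
  funext i
  refine φ.injective i _ _ fun w hw => ?_
  have := congrFun h w
  simpa [BlockEmbedding.toFun, hw] using this

theorem map_iterate_of_map_step {α β : Type} {F : α → α} {G : β → β} {Φ : α → β} {T : ℕ}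
    (h : ∀ x, Φ (F x) = G^[T] (Φ x)) (s : ℕ) (x : α) : Φ (F^[s] x) = G^[T * s] (Φ x) := by
  induction s with
  | zero => simp
  | succ s ih =>
    rw [Function.iterate_succ_apply', h, ih, Nat.mul_succ, add_comm, Function.iterate_add_apply]

theorem mem_periodicPts_of_map_step {α β : Type} {F : α → α} {G : β → β} {Φ : α → β} {T : ℕ}
    (hΦ : Function.Injective Φ) (h : ∀ x, Φ (F x) = G^[T] (Φ x)) {x : α}
    (hx : Φ x ∈ Function.periodicPts G) : x ∈ Function.periodicPts F := by
  obtain ⟨N, hN, hper⟩ := hx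
  refine ⟨N, hN, hΦ ?_⟩
  rw [map_iterate_of_map_step h, mul_comm, Function.iterate_mul]
  exact Function.iterate_fixed hper T

/-- The periods of a network that is simulated by a network of gates with `m` nodes divide
`lcm (1, …, m)`. -/
theorem Simulates.iterate_lcmUpto {Q V : Type} {m : ℕ} {G : Network (Fin 3) (Fin m)}
    (hG : G ∈ gateNetworks gatesT m) {F : Network Q V} {φ : BlockEmbedding Q V (Fin 3) (Fin m)}
    {T : ℕ} (h : Simulates G F φ T) {x : V → Q} (hx : x ∈ Function.periodicPts F) :
    F^[Nat.lcmUpto m] x = x := by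
  obtain ⟨W, rfl⟩ := hG
  apply φ.toFun_injective
  rcases Nat.eq_zero_or_pos T with rfl | hT
  -- With time constant 0 the embedding sends F x and x to the same configuration, so F is the
  -- identity.
  · rw [map_iterate_of_map_step h, zero_mul, Function.iterate_zero, id]
  · have hper : φ.toFun x ∈ Function.periodicPts W.network := by
      obtain ⟨N, hN, hp⟩ := hx
      exact ⟨T * N, Nat.mul_pos hT hN, by
        rw [Function.IsPeriodicPt, Function.IsFixedPt, ← map_iterate_of_map_step h, hp.eq]⟩
    have hL := W.iterate_lcmUpto hper
    rw [Fintype.card_fin] at hL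
    rw [map_iterate_of_map_step h, mul_comm, Function.iterate_mul]
    exact Function.iterate_fixed hL T

/-! ### The binary counter -/

/-- The network that increments a number written in binary, the node `i` holding the bit `i`. -/
def binaryCounter (n : ℕ) : Network (Fin 2) (Fin n) :=
  fun x i => if ∀ j < i, x j = 1 then x i + 1 else x i

/-- Adding 1 flips exactly the bits reached by the carry. -/
theorem testBit_succ_iff (t i : ℕ) :
    (t + 1).testBit i = (t.testBit i ^^ decide (2 ^ i ∣ t + 1)) := by
  simp only [Nat.testBit_eq_decide_div_mod_eq, Nat.succ_div]
  by_cases h : 2 ^ i ∣ t + 1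
  · rcases Nat.mod_two_eq_zero_or_one (t / 2 ^ i) with h2 | h2
    · simp [h, h2, Nat.add_mod]
    · simp [h, h2, Nat.add_mod]
  · simp [h]

/-- The carry reaches position i exactly when all lower bits are 1, which is the rule of the
counter. -/
theorem two_pow_dvd_succ_iff (t i : ℕ) : 2 ^ i ∣ t + 1 ↔ ∀ j < i, t.testBit j = true := by
  induction i with
  | zero => simp
  | succ i ih =>
    have h1 : (∀ j < i + 1, t.testBit j = true) ↔
        (∀ j < i, t.testBit j = true) ∧ t.testBit i = true := by
      constructor
      · exact fun h => ⟨fun j hj => h j (by omega), h i (by omega)⟩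
      · rintro ⟨h, h'⟩ j hj
        rcases Nat.lt_succ_iff_lt_or_eq.1 hj with hj | rfl
        · exact h j hj
        · exact h'
    rw [h1, ← ih]
    have h2 : 2 ^ (i + 1) ∣ t + 1 ↔ 2 ^ i ∣ t + 1 ∧ (t + 1).testBit i = false := by
      constructor
      · intro h
        refine ⟨(pow_dvd_pow 2 (Nat.le_succ i)).trans h, ?_⟩
        obtain ⟨c, hc⟩ := h
        rw [hc, Nat.testBit_eq_decide_div_mod_eq, pow_succ, mul_assoc,
          Nat.mul_div_cancel_left _ (by positivity)]
        simp
      · rintro ⟨⟨c, hc⟩, h⟩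
        rw [hc, Nat.testBit_eq_decide_div_mod_eq, Nat.mul_div_cancel_left _ (by positivity)] at h
        obtain ⟨d, rfl⟩ : 2 ∣ c := by
          simp at h; omega
        exact ⟨d, by rw [hc]; ring⟩
    rw [h2]
    refine and_congr_right fun h => ?_
    rw [testBit_succ_iff]
    simp [h]

theorem binaryCounter_iterate (n t : ℕ) :
    (binaryCounter n)^[t] (fun _ => 0) = fun i : Fin n => if t.testBit i then 1 else 0 := by
  induction t with
  | zero => simp
  | succ t ih =>
    rw [Function.iterate_succ_apply', ih]
    funext i
    have h1 : (∀ j < i, (if t.testBit j then 1 else 0 : Fin 2) = 1) ↔ 2 ^ (i : ℕ) ∣ t + 1 := by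
      rw [two_pow_dvd_succ_iff]
      constructor
      · intro h j hj
        simpa using h ⟨j, hj.trans i.2⟩ hj
      · intro h j hj
        simp [h j hj]
    simp only [binaryCounter, h1, testBit_succ_iff]
    by_cases h : 2 ^ (i : ℕ) ∣ t + 1 <;> cases t.testBit i <;> simp [h]

/-- The zero configuration has period exactly 2^n: the configuration at time t is t modulo 2^n. -/
theorem binaryCounter_iterate_eq_iff (n t : ℕ) :
    (binaryCounter n)^[t] (fun _ => 0) = (fun _ => 0) ↔ 2 ^ n ∣ t := by
  rw [binaryCounter_iterate]
  rcases t with _ | t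
  · simp
  rw [funext_iff]
  simp only [ite_eq_right_iff, one_ne_zero, imp_false, Bool.not_eq_true]
  constructor
  · intro h
    have key : ∀ i ≤ n, 2 ^ i ∣ t + 1 := by
      intro i
      induction i with
      | zero => simp
      | succ i ih =>
        intro hi
        rw [two_pow_dvd_succ_iff]
        intro j hj
        rcases Nat.lt_succ_iff_lt_or_eq.1 hj with hj | rfl
        · exact (two_pow_dvd_succ_iff _ _).1 (ih (by omega)) j hj
        -- Bit j of t + 1 is 0 and was reached by the carry, so bit j of t is 1 and the carry goes
        -- on.
        · have h2 := h ⟨j, hi⟩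
          rw [testBit_succ_iff] at h2
          simpa [ih (by omega)] using h2
    exact key n le_rfl
  · intro h i
    rw [testBit_succ_iff]
    simp only [(pow_dvd_pow 2 i.2.le).trans h, (two_pow_dvd_succ_iff _ _).1 h i i.2]
    simp

/-- The exponent of 2 in lcm(1, …, m) is the integer part of log₂ m, which is less than n. -/
theorem not_two_pow_dvd_lcmUpto {n m : ℕ} (hn : n ≠ 0) (h : m < 2 ^ n) :
    ¬ 2 ^ n ∣ Nat.lcmUpto m := by
  intro hd
  rw [Nat.prime_two.pow_dvd_iff_le_factorization (Nat.lcmUpto_ne_zero m),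
    Nat.factorization_lcmUpto m Nat.prime_two] at hd
  rcases Nat.eq_zero_or_pos m with rfl | hm
  · simp only [Nat.log_zero_right, nonpos_iff_eq_zero] at hd
    exact hn hd
  · exact absurd (Nat.log_lt_of_lt_pow hm.ne' h) (by omega)

/-- A circuit encoding of the binary counter: for each node the vertices compute its bit, the carry,
their negations, and the two bits of the code of its next state. -/
def counterCircuit (n : ℕ) : Circuit (n * 2) (n * 2) where
  size := n * 8
  vertex j :=
    -- Node i owns the vertices 8i, …, 8i + 7. Input 2i + 1 is the code bit telling that node i is
    -- in state 1. Vertices 4, 5 and 6 form the exclusive or of bit and carry, and vertex 7 is its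
    -- negation, the code bit of state 0.
    if h0 : j.1 % 8 = 0 then .input ⟨2 * (j.1 / 8) + 1, by have := j.2; omega⟩
    else if h1 : j.1 % 8 = 1 then
      if hc : j.1 / 8 = 0 then .const true
      else .and ⟨8 * (j.1 / 8 - 1), by omega⟩ ⟨8 * (j.1 / 8 - 1) + 1, by omega⟩
    else if h2 : j.1 % 8 = 2 then .not ⟨8 * (j.1 / 8), by omega⟩
    else if h3 : j.1 % 8 = 3 then .not ⟨8 * (j.1 / 8) + 1, by omega⟩
    else if h4 : j.1 % 8 = 4 then .and ⟨8 * (j.1 / 8), by omega⟩ ⟨8 * (j.1 / 8) + 3, by omega⟩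
    else if h5 : j.1 % 8 = 5 then .and ⟨8 * (j.1 / 8) + 2, by omega⟩ ⟨8 * (j.1 / 8) + 1, by omega⟩
    else if h6 : j.1 % 8 = 6 then .or ⟨8 * (j.1 / 8) + 4, by omega⟩ ⟨8 * (j.1 / 8) + 5, by omega⟩
    else .not ⟨8 * (j.1 / 8) + 6, by omega⟩
  output i := ⟨8 * (i.1 / 2) + (if i.1 % 2 = 1 then 6 else 7), by
    have := i.2
    split_ifs <;> omega⟩

theorem Circuit.value_input {a b : ℕ} {C : Circuit a b} {x : Fin a → Bool} {j : ℕ}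
    {hj : j < C.size} {i : Fin a} (h : C.vertex ⟨j, hj⟩ = .input i) : C.value x j hj = x i := by
  rw [Circuit.value, h]

theorem Circuit.value_const {a b : ℕ} {C : Circuit a b} {x : Fin a → Bool} {j : ℕ}
    {hj : j < C.size} {c : Bool} (h : C.vertex ⟨j, hj⟩ = .const c) : C.value x j hj = c := by
  rw [Circuit.value, h]

theorem Circuit.value_not {a b : ℕ} {C : Circuit a b} {x : Fin a → Bool} {j : ℕ}
    {hj : j < C.size} {u : Fin j} (h : C.vertex ⟨j, hj⟩ = .not u) :
    C.value x j hj = !(C.value x u (u.2.trans hj)) := by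
  rw [Circuit.value, h]

theorem Circuit.value_and {a b : ℕ} {C : Circuit a b} {x : Fin a → Bool} {j : ℕ}
    {hj : j < C.size} {u v : Fin j} (h : C.vertex ⟨j, hj⟩ = .and u v) :
    C.value x j hj = (C.value x u (u.2.trans hj) && C.value x v (v.2.trans hj)) := by
  rw [Circuit.value, h]

theorem Circuit.value_or {a b : ℕ} {C : Circuit a b} {x : Fin a → Bool} {j : ℕ}
    {hj : j < C.size} {u v : Fin j} (h : C.vertex ⟨j, hj⟩ = .or u v) :
    C.value x j hj = (C.value x u (u.2.trans hj) || C.value x v (v.2.trans hj)) := by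
  rw [Circuit.value, h]

theorem counterCircuit_bit {n i : ℕ} (hi : i < n) (x : Fin n → Fin 2) :
    (counterCircuit n).value (codeConfig x) (8 * i) (by simp only [counterCircuit]; omega) =
      decide (x ⟨i, hi⟩ = 1) := by
  rw [Circuit.value_input (i := finProdFinEquiv (⟨i, hi⟩, 1))]
  · simp [codeConfig]
  · simp only [counterCircuit]
    rw [dif_pos (by omega)]
    congr 1
    ext
    simp [finProdFinEquiv]
    omega

theorem counterCircuit_carry {n i : ℕ} (hi : i < n) (x : Fin n → Fin 2) :
    (counterCircuit n).value (codeConfig x) (8 * i + 1) (by simp only [counterCircuit]; omega) =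
      decide (∀ j < (⟨i, hi⟩ : Fin n), x j = 1) := by
  induction i with
  | zero =>
    rw [Circuit.value_const (c := true)]
    · symm
      rw [decide_eq_true_iff]
      exact fun j hj => absurd hj (Nat.not_lt_zero _)
    · simp [counterCircuit]
  | succ i ih =>
    rw [Circuit.value_and (u := ⟨8 * i, by omega⟩) (v := ⟨8 * i + 1, by omega⟩)]
    · simp only
      rw [counterCircuit_bit (by omega), ih (by omega), ← Bool.decide_and]
      congr 1
      refine propext ⟨?_, fun h => ⟨h ⟨i, by omega⟩ (Nat.lt_succ_self i),
        fun j hj => h j (lt_trans hj (Nat.lt_succ_self i))⟩⟩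
      rintro ⟨h1, h2⟩ j hj
      rcases Nat.lt_succ_iff_lt_or_eq.1 hj with h | h
      · exact h2 j h
      · have hji : j = ⟨i, by omega⟩ := Fin.ext h
        rw [hji]
        exact h1
    · simp only [counterCircuit]
      rw [dif_neg (by omega), dif_pos (by omega), dif_neg (by omega)]
      congr 2 <;> omega

theorem counterCircuit_next {n i : ℕ} (hi : i < n) (x : Fin n → Fin 2) :
    (counterCircuit n).value (codeConfig x) (8 * i + 6) (by simp only [counterCircuit]; omega) =
      decide (binaryCounter n x ⟨i, hi⟩ = 1) := by
  have h2 : (counterCircuit n).value (codeConfig x) (8 * i + 2)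
      (by simp only [counterCircuit]; omega) = !decide (x ⟨i, hi⟩ = 1) := by
    rw [Circuit.value_not (u := ⟨8 * i, by omega⟩), ← counterCircuit_bit]
    simp only [counterCircuit]
    rw [dif_neg (by omega), dif_neg (by omega), dif_pos (by omega)]
    congr 2
    omega
  have h3 : (counterCircuit n).value (codeConfig x) (8 * i + 3)
      (by simp only [counterCircuit]; omega) =
        !decide (∀ j < (⟨i, hi⟩ : Fin n), x j = 1) := by
    rw [Circuit.value_not (u := ⟨8 * i + 1, by omega⟩), ← counterCircuit_carry]
    simp only [counterCircuit]
    rw [dif_neg (by omega), dif_neg (by omega), dif_neg (by omega), dif_pos (by omega)]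
    congr 2
    omega
  rw [Circuit.value_or (u := ⟨8 * i + 4, by omega⟩) (v := ⟨8 * i + 5, by omega⟩),
    Circuit.value_and (j := 8 * i + 4) (u := ⟨8 * i, by omega⟩) (v := ⟨8 * i + 3, by omega⟩),
    Circuit.value_and (j := 8 * i + 5) (u := ⟨8 * i + 2, by omega⟩) (v := ⟨8 * i + 1, by omega⟩)]
  · simp only
    rw [h2, h3, counterCircuit_bit hi, counterCircuit_carry hi]
    have ha : ∀ a : Fin 2, decide (a + 1 = 1) = !decide (a = 1) := by decide
    by_cases h : ∀ j < (⟨i, hi⟩ : Fin n), x j = 1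
    · have hb : binaryCounter n x ⟨i, hi⟩ = x ⟨i, hi⟩ + 1 := if_pos h
      rw [hb, ha, decide_eq_true h]
      simp
    · have hb : binaryCounter n x ⟨i, hi⟩ = x ⟨i, hi⟩ := if_neg h
      rw [hb, decide_eq_false h]
      simp
  · simp only [counterCircuit]
    rw [dif_neg (by omega), dif_neg (by omega), dif_neg (by omega), dif_neg (by omega),
      dif_neg (by omega), dif_pos (by omega)]
    congr 2 <;> omega
  · simp only [counterCircuit]
    rw [dif_neg (by omega), dif_neg (by omega), dif_neg (by omega), dif_neg (by omega),
      dif_pos (by omega)]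
    congr 2 <;> omega
  · simp only [counterCircuit]
    rw [dif_neg (by omega), dif_neg (by omega), dif_neg (by omega), dif_neg (by omega),
      dif_neg (by omega), dif_neg (by omega), dif_pos (by omega)]
    congr 2 <;> omega

theorem counterCircuit_encodes (n : ℕ) : (counterCircuit n).Encodes (binaryCounter n) := by
  intro x
  funext e
  obtain ⟨⟨⟨i, hi⟩, a⟩, rfl⟩ := finProdFinEquiv.surjective e
  have h6 := counterCircuit_next hi x
  have h7 : (counterCircuit n).value (codeConfig x) (8 * i + 7)
      (by simp only [counterCircuit]; omega) = !decide (binaryCounter n x ⟨i, hi⟩ = 1) := by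
    rw [Circuit.value_not (u := ⟨8 * i + 6, by omega⟩), ← h6]
    simp only [counterCircuit]
    rw [dif_neg (by omega), dif_neg (by omega), dif_neg (by omega), dif_neg (by omega),
      dif_neg (by omega), dif_neg (by omega), dif_neg (by omega)]
    congr 2
    omega
  have hcode : codeConfig (binaryCounter n x) (finProdFinEquiv (⟨i, hi⟩, a)) =
      decide (binaryCounter n x ⟨i, hi⟩ = a) := by
    simp [codeConfig]
  have hout : ((counterCircuit n).output (finProdFinEquiv (⟨i, hi⟩, a))).1 =
      8 * i + if a = 1 then 6 else 7 := by
    fin_cases a <;> simp [counterCircuit, finProdFinEquiv, Nat.add_mod]; omega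
  have hval : ∀ j hj k hk, j = k → (counterCircuit n).value (codeConfig x) j hj =
      (counterCircuit n).value (codeConfig x) k hk := by
    rintro j hj k hk rfl; rfl
  rw [hcode, Circuit.eval]
  fin_cases a
  · rw [hval _ _ (8 * i + 7) (by simp only [counterCircuit]; omega) (by simpa using hout), h7]
    generalize binaryCounter n x ⟨i, hi⟩ = b
    revert b; decide
  · rw [hval _ _ (8 * i + 6) (by simp only [counterCircuit]; omega) (by simpa using hout), h6]
    rfl

theorem exists_polynomial_eval_lt_two_pow (P : Polynomial ℕ) :
    ∃ n : ℕ, n ≠ 0 ∧ P.eval n < 2 ^ n := by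
  -- For n ≥ 1 each monomial is at most its coefficient times n^deg, and the coefficients sum to
  -- P(1).
  have hP : ∀ n : ℕ, 1 ≤ n → P.eval n ≤ P.eval 1 * n ^ P.natDegree := by
    intro n hn
    rw [Polynomial.eval_eq_sum_range, Polynomial.eval_eq_sum_range, Finset.sum_mul]
    refine Finset.sum_le_sum fun i hi => ?_
    rw [one_pow, mul_one]
    exact Nat.mul_le_mul_left _ (Nat.pow_le_pow_right hn (by simpa [Nat.lt_succ_iff] using hi))
  -- The threshold 1 / (P(1) + 1) absorbs the factor P(1); the added 1 keeps it defined when P(1) =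
  -- 0.
  have hlim := (tendsto_pow_const_div_const_pow_of_one_lt P.natDegree (r := (2 : ℝ))
    one_lt_two).eventually (gt_mem_nhds (a := (1 : ℝ) / (P.eval 1 + 1)) (by positivity))
  obtain ⟨n, hn, hn1⟩ := (hlim.and (Filter.eventually_ge_atTop 1)).exists
  refine ⟨n, by omega, (hP n hn1).trans_lt ?_⟩
  rw [div_lt_div_iff₀ (by positivity) (by positivity), one_mul] at hn
  have h2 : n ^ P.natDegree * (P.eval 1 + 1) < 2 ^ n := by exact_mod_cast hn
  exact lt_of_le_of_lt (by nlinarith [Nat.zero_le (n ^ P.natDegree)]) h2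

/-! ### Non-universality -/

/-- For n with S(n) < 2^n the counter would have its period 2^n dividing lcm(1, …, m) with m ≤ S(n).
-/
theorem not_isNonuniformlyUniversal_gatesT :
    ¬ (gateNetworks gatesT).IsNonuniformlyUniversal := by
  intro h
  obtain ⟨T, S, -, ⟨P, hP⟩, hsim⟩ := h 2 two_pos (8 * Polynomial.X)
  obtain ⟨n, hn, hlt⟩ := exists_polynomial_eval_lt_two_pow P
  obtain ⟨m, hm, G, hG, φ, t, -, hφ⟩ := hsim n (binaryCounter n) (counterCircuit n)
    (by simp [counterCircuit, mul_comm]) (counterCircuit_encodes n)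
  have hper : (fun _ => 0) ∈ Function.periodicPts (binaryCounter n) :=
    ⟨2 ^ n, by positivity, (binaryCounter_iterate_eq_iff n _).2 dvd_rfl⟩
  exact not_two_pow_dvd_lcmUpto hn (hm.trans_lt ((hP n).trans_lt hlt))
    ((binaryCounter_iterate_eq_iff n _).1 (hφ.iterate_lcmUpto hG hper))

theorem isNonuniformlyUniversal_of_isUniversal {q : ℕ} {𝓖 : Set (Gate (Fin q))} {Δ : ℕ}
    (h : (gateNetworkRepresentation 𝓖 Δ).IsUniversal) :
    (gateNetworks 𝓖).IsNonuniformlyUniversal := by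
  intro r hr P
  obtain ⟨T, S, hT, hS, M, -, hM⟩ := h r hr P
  refine ⟨T, S, hT, hS, fun n H C hC hE => ?_⟩
  obtain ⟨w', F, φ, -, hF, hsim⟩ := hM C.word n H ⟨C, hC, hE, rfl⟩
  exact ⟨S n, le_rfl, F, hF.1, φ, T n, le_rfl, hsim⟩

/-! ### Assembling coherent gadgets along a wiring -/

section Glueing

variable {Q V₁ V₂ C₁ C₂ : Type} {φ₁ : C₁ ⊕ C₂ → V₁} {φ₂ : C₁ ⊕ C₂ → V₂}

/-- The configuration of a glueing made of configurations of the two networks. -/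
def glueConfig (φ₁ : C₁ ⊕ C₂ → V₁) (φ₂ : C₁ ⊕ C₂ → V₂) (x₁ : V₁ → Q) (x₂ : V₂ → Q) :
    GlueNodes φ₁ φ₂ → Q
  | .inl d => x₁ (φ₁ d)
  | .inr (.inl v) => x₁ v.1
  | .inr (.inr v) => x₂ v.1

/-- No agreement is needed on this side, as `glueConfig` fills the dowel from the first network; the
second restriction does need it. -/
theorem glueRestrict₁_glueConfig (x₁ : V₁ → Q) (x₂ : V₂ → Q) :
    glueRestrict₁ φ₁ φ₂ (glueConfig φ₁ φ₂ x₁ x₂) = x₁ := by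
  funext v
  unfold glueRestrict₁
  split_ifs with h
  · exact congrArg x₁ h.choose_spec
  · rfl

theorem glueRestrict₂_glueConfig {x₁ : V₁ → Q} {x₂ : V₂ → Q} (h : ∀ d, x₁ (φ₁ d) = x₂ (φ₂ d)) :
    glueRestrict₂ φ₁ φ₂ (glueConfig φ₁ φ₂ x₁ x₂) = x₂ := by
  funext v
  unfold glueRestrict₂
  split_ifs with hv
  · exact (h _).trans (congrArg x₂ hv.choose_spec)
  · rfl

/-- The dowel is counted among the nodes of the first network, so sizes are at most added; this
keeps assembled gadgets of linear size. -/
theorem card_glueNodes_le [Finite V₁] [Finite V₂] (hφ : Function.Injective φ₁) :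
    Nat.card (GlueNodes φ₁ φ₂) ≤ Nat.card V₁ + Nat.card V₂ := by
  rw [← Nat.card_sum]
  refine Nat.card_le_card_of_injective
    (Sum.elim (fun d => Sum.inl (φ₁ d)) (Sum.map Subtype.val Subtype.val)) ?_
  rintro (d | v | v) (e | w | w) h <;>
    simp only [Sum.elim_inl, Sum.elim_inr, Sum.map_inl, Sum.map_inr, Sum.inl.injEq, Sum.inr.injEq,
      reduceCtorEq] at h
  · rw [hφ h]
  · exact absurd ⟨d, h⟩ w.2
  · exact absurd ⟨e, h.symm⟩ v.2
  · rw [Subtype.ext h]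
  · rw [Subtype.ext h]

end Glueing

namespace Gadget

variable {Q R Ci Co I O J P A B : Type}

theorem dowelFst_injective (X : Gadget R Ci Co I O) (σ : A ↪ I) (τ : B ↪ O) :
    Function.Injective (X.dowelFst σ τ) := by
  rintro ((⟨a, c⟩ | ⟨a, c⟩) | (⟨a, c⟩ | ⟨a, c⟩)) ((⟨b, d⟩ | ⟨b, d⟩) | (⟨b, d⟩ | ⟨b, d⟩)) h <;>
    simp only [dowelFst] at h <;>
    first
      | exact absurd h (X.inp_ne_out _ _ _ _)
      | exact absurd h.symm (X.inp_ne_out _ _ _ _)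
      | (have := X.inp_inj h; simp_all)
      | (have := X.out_inj h; simp_all)

/-- The nodes whose behaviour is not determined by the gadget: they wait for a glueing. -/
def dangling (X : Gadget R Ci Co I O) : Set X.V :=
  {v | ∃ k c, X.inp k (.inr c) = v} ∪ {v | ∃ k c, X.out k (.inl c) = v}

theorem inp_inl_notMem_dangling (X : Gadget R Ci Co I O) (k : I) (c : Ci) :
    X.inp k (.inl c) ∉ X.dangling := by
  rintro (⟨k', c', h⟩ | ⟨k', c', h⟩)
  · simpa using (X.inp_inj h).2
  · exact X.inp_ne_out _ _ _ _ h.symm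

theorem out_inr_notMem_dangling (X : Gadget R Ci Co I O) (k : O) (c : Co) :
    X.out k (.inr c) ∉ X.dangling := by
  rintro (⟨k', c', h⟩ | ⟨k', c', h⟩)
  · exact X.inp_ne_out _ _ _ _ h
  · simpa using (X.out_inj h).2

/-- A family of pseudo-orbits of a glueing, made of families of pseudo-orbits of the two gadgets that
agree on the dowel. -/
theorem glueing_isPseudoOrbit {X : Gadget R Ci Co I O} {Y : Gadget R Ci Co J P} (σX : A ↪ I)
    (σY : A ↪ P) (τX : B ↪ O) (τY : B ↪ J) {T : ℕ} {x : ℕ → X.V → R} {y : ℕ → Y.V → R}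
    (hx : X.net.IsPseudoOrbit X.dangling T x) (hy : Y.net.IsPseudoOrbit Y.dangling T y)
    (hA : ∀ t ≤ T, ∀ a c, x t (X.inp (σX a) c) = y t (Y.out (σY a) c))
    (hB : ∀ t ≤ T, ∀ b c, x t (X.out (τX b) c) = y t (Y.inp (τY b) c)) :
    (X.glueing Y σX σY τX τY).net.IsPseudoOrbit (X.glueing Y σX σY τX τY).dangling T
      (fun t => glueConfig (X.dowelFst σX τX) (Y.dowelSnd σY τY) (x t) (y t)) := by
  have hagree : ∀ t ≤ T, ∀ d, x t (X.dowelFst σX τX d) = y t (Y.dowelSnd σY τY d) := by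
    rintro t ht ((⟨a, c⟩ | ⟨b, c⟩) | (⟨a, c⟩ | ⟨b, c⟩))
    · exact hA t ht a _
    · exact hB t ht b _
    · exact hA t ht a _
    · exact hB t ht b _
  intro t ht v hv
  rcases v with ((c | c) | (v | v))
  · change x (t + 1) _ = X.net (glueRestrict₁ _ _ _) _
    rw [glueRestrict₁_glueConfig]
    refine hx t ht _ ?_
    rcases c with ⟨a, c⟩ | ⟨b, c⟩
    · exact X.inp_inl_notMem_dangling _ _
    · exact X.out_inr_notMem_dangling _ _
  · change x (t + 1) _ = Y.net (glueRestrict₂ _ _ _) _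
    rw [glueRestrict₂_glueConfig (hagree t ht.le), hagree (t + 1) ht]
    refine hy t ht _ ?_
    rcases c with ⟨a, c⟩ | ⟨b, c⟩
    · exact Y.out_inr_notMem_dangling _ _
    · exact Y.inp_inl_notMem_dangling _ _
  · change x (t + 1) _ = X.net (glueRestrict₁ _ _ _) _
    rw [glueRestrict₁_glueConfig]
    -- A dangling node outside the dowel belongs to an interface copy that was not glued, so it is
    -- still dangling in the glueing and was excluded.
    refine hx t ht _ fun hdang => ?_
    obtain ⟨v, hvd⟩ := v
    rcases hdang with ⟨k, c, rfl⟩ | ⟨k, c, rfl⟩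
    · by_cases hk : k ∈ Set.range σX
      · obtain ⟨a, rfl⟩ := hk
        exact hvd ⟨.inr (.inl (a, c)), rfl⟩
      · exact hv (.inl ⟨.inl ⟨k, hk⟩, c, rfl⟩)
    · by_cases hk : k ∈ Set.range τX
      · obtain ⟨b, rfl⟩ := hk
        exact hvd ⟨.inr (.inr (b, c)), rfl⟩
      · exact hv (.inr ⟨.inl ⟨k, hk⟩, c, rfl⟩)
  · change y (t + 1) _ = Y.net (glueRestrict₂ _ _ _) _
    rw [glueRestrict₂_glueConfig (hagree t ht.le)]
    refine hy t ht _ fun hdang => ?_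
    obtain ⟨v, hvd⟩ := v
    rcases hdang with ⟨k, c, rfl⟩ | ⟨k, c, rfl⟩
    · by_cases hk : k ∈ Set.range τY
      · obtain ⟨b, rfl⟩ := hk
        exact hvd ⟨.inl (.inr (b, c)), rfl⟩
      · exact hv (.inl ⟨.inr ⟨k, hk⟩, c, rfl⟩)
    · by_cases hk : k ∈ Set.range σY
      · obtain ⟨a, rfl⟩ := hk
        exact hvd ⟨.inl (.inl (a, c)), rfl⟩
      · exact hv (.inr ⟨.inr ⟨k, hk⟩, c, rfl⟩)

end Gadget

namespace Wiring

variable {Q R V Ci Co : Type} {𝓖 : Set (Gate Q)} (W : Wiring 𝓖 V)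

/-- The gate that reads the node `v`. -/
def target (v : V) : Fin W.numGates := (W.inputs.symm v).1

/-- The gate that computes the node `v`. -/
def source (v : V) : Fin W.numGates := (W.outputs v).1

/-- The gadget `Y` realizes the part of the wiring formed by the gates in `S`: its inputs and outputs
are the nodes at the boundary of `S`, and each step of the network on a configuration `q` is carried
out by a pseudo-orbit of `Y` of length `T`. -/
structure Realization (W : Wiring 𝓖 V) (S : Set (Fin W.numGates)) (T : ℕ)
    (trace : Q → Q → ℕ → Ci ⊕ Co → R) {I O : Type} (Y : Gadget R Ci Co I O) where
  inp : I → V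
  out : O → V
  orbit : (V → Q) → ℕ → Y.V → R
  inp_injective : Function.Injective inp
  out_injective : Function.Injective out
  range_inp : Set.range inp = {v | W.target v ∈ S ∧ W.source v ∉ S}
  range_out : Set.range out = {v | W.source v ∈ S ∧ W.target v ∉ S}
  isPseudoOrbit : ∀ q, Y.net.IsPseudoOrbit Y.dangling T (orbit q)
  trace_inp : ∀ q, ∀ t ≤ T, ∀ k c,
    orbit q t (Y.inp k c) = trace (q (inp k)) (W.network q (inp k)) t c
  trace_out : ∀ q, ∀ t ≤ T, ∀ k c,
    orbit q t (Y.out k c) = trace (q (out k)) (W.network q (out k)) t c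
  -- Pseudo-orbits for consecutive configurations of the wiring chain together.
  orbit_last : ∀ q, orbit q T = orbit (W.network q) 0
  orbit_zero_injective : ∀ q q', orbit q 0 = orbit q' 0 → ∀ v, W.source v ∈ S → q v = q' v

variable {W} in
/-- The glueing of realizations of disjoint sets of gates along all the nodes between them. -/
theorem Realization.exists_glueing {S₁ S₂ : Set (Fin W.numGates)} (hS : Disjoint S₁ S₂) {T : ℕ}
    {trace : Q → Q → ℕ → Ci ⊕ Co → R} {I O J P : Type} {Y₁ : Gadget R Ci Co I O}
    {Y₂ : Gadget R Ci Co J P} (r₁ : W.Realization S₁ T trace Y₁)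
    (r₂ : W.Realization S₂ T trace Y₂) :
    ∃ (A B : Type) (σ₁ : A ↪ I) (σ₂ : A ↪ P) (τ₁ : B ↪ O) (τ₂ : B ↪ J),
      Nonempty (W.Realization (S₁ ∪ S₂) T trace (Y₁.glueing Y₂ σ₁ σ₂ τ₁ τ₂)) := by
  have hS' : ∀ {j}, j ∈ S₁ → j ∉ S₂ := fun h h' => Set.disjoint_left.1 hS h h'
  have mi₁ : ∀ v, v ∈ Set.range r₁.inp ↔ W.target v ∈ S₁ ∧ W.source v ∉ S₁ := fun v => by
    rw [r₁.range_inp]; rfl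
  have mo₁ : ∀ v, v ∈ Set.range r₁.out ↔ W.source v ∈ S₁ ∧ W.target v ∉ S₁ := fun v => by
    rw [r₁.range_out]; rfl
  have mi₂ : ∀ v, v ∈ Set.range r₂.inp ↔ W.target v ∈ S₂ ∧ W.source v ∉ S₂ := fun v => by
    rw [r₂.range_inp]; rfl
  have mo₂ : ∀ v, v ∈ Set.range r₂.out ↔ W.source v ∈ S₂ ∧ W.target v ∉ S₂ := fun v => by
    rw [r₂.range_out]; rfl
  -- The wires between the two sets of gates: `A` from S₂ to S₁ and `B` from S₁ to S₂. Disjointness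
  -- makes each of them an output of one gadget and an input of the other.
  let A := {v : V // W.target v ∈ S₁ ∧ W.source v ∈ S₂}
  let B := {v : V // W.source v ∈ S₁ ∧ W.target v ∈ S₂}
  have hσ₁ : ∀ a : A, ∃ i, r₁.inp i = a := fun a =>
    (mi₁ a.1).2 ⟨a.2.1, fun h => hS' h a.2.2⟩
  have hσ₂ : ∀ a : A, ∃ i, r₂.out i = a := fun a =>
    (mo₂ a.1).2 ⟨a.2.2, fun h => hS' a.2.1 h⟩
  have hτ₁ : ∀ b : B, ∃ i, r₁.out i = b := fun b =>
    (mo₁ b.1).2 ⟨b.2.1, fun h => hS' h b.2.2⟩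
  have hτ₂ : ∀ b : B, ∃ i, r₂.inp i = b := fun b =>
    (mi₂ b.1).2 ⟨b.2.2, fun h => hS' b.2.1 h⟩
  choose σ₁ hσ₁ using hσ₁
  choose σ₂ hσ₂ using hσ₂
  choose τ₁ hτ₁ using hτ₁
  choose τ₂ hτ₂ using hτ₂
  have inj : ∀ {D : Type} {U : V → Prop} {f : {v : V // U v} → D} {g : D → V},
      (∀ a, g (f a) = a) → Function.Injective f := fun h a b hab =>
    Subtype.ext (by rw [← h a, ← h b, hab])
  have notMem : ∀ {D : Type} {U : V → Prop} {f : {v : V // U v} → D} {g : D → V},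
      Function.Injective g → (∀ a, g (f a) = a) → ∀ d, d ∉ Set.range f ↔ ¬ U (g d) := by
    intro D U f g hg h d
    refine not_congr ⟨?_, fun hd => ⟨⟨g d, hd⟩, hg (h _)⟩⟩
    rintro ⟨a, rfl⟩
    rw [h]
    exact a.2
  have ni₁ := notMem r₁.inp_injective hσ₁
  have no₁ := notMem r₁.out_injective hτ₁
  have ni₂ := notMem r₂.inp_injective hτ₂
  have no₂ := notMem r₂.out_injective hσ₂
  -- Both copies of a wire follow the trace from its current state to its next state, whichever
  -- gadget it is seen from.
  have hA : ∀ q, ∀ t ≤ T, ∀ a c,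
      r₁.orbit q t (Y₁.inp (σ₁ a) c) = r₂.orbit q t (Y₂.out (σ₂ a) c) := fun q t ht a c => by
    rw [r₁.trace_inp q t ht, r₂.trace_out q t ht, hσ₁, hσ₂]
  have hB : ∀ q, ∀ t ≤ T, ∀ b c,
      r₁.orbit q t (Y₁.out (τ₁ b) c) = r₂.orbit q t (Y₂.inp (τ₂ b) c) := fun q t ht b c => by
    rw [r₁.trace_out q t ht, r₂.trace_inp q t ht, hτ₁, hτ₂]
  refine ⟨A, B, ⟨σ₁, inj hσ₁⟩, ⟨σ₂, inj hσ₂⟩, ⟨τ₁, inj hτ₁⟩, ⟨τ₂, inj hτ₂⟩, ⟨{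
    inp := Sum.elim (fun i => r₁.inp i.1) (fun i => r₂.inp i.1)
    out := Sum.elim (fun i => r₁.out i.1) (fun i => r₂.out i.1)
    orbit := fun q t => glueConfig _ _ (r₁.orbit q t) (r₂.orbit q t)
    inp_injective := ?_
    out_injective := ?_
    range_inp := ?_
    range_out := ?_
    isPseudoOrbit := fun q => Gadget.glueing_isPseudoOrbit _ _ _ _ (r₁.isPseudoOrbit q)
      (r₂.isPseudoOrbit q) (hA q) (hB q)
    trace_inp := ?_
    trace_out := ?_
    orbit_last := ?_
    orbit_zero_injective := ?_ }⟩⟩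
  · refine Function.Injective.sumElim (r₁.inp_injective.comp Subtype.val_injective)
      (r₂.inp_injective.comp Subtype.val_injective) fun i j h => ?_
    have h1 := ((mi₁ _).1 ⟨i.1, rfl⟩).1
    have h2 := ((mi₂ _).1 ⟨j.1, rfl⟩).1
    exact hS' h1 (h ▸ h2)
  · refine Function.Injective.sumElim (r₁.out_injective.comp Subtype.val_injective)
      (r₂.out_injective.comp Subtype.val_injective) fun i j h => ?_
    have h1 := ((mo₁ _).1 ⟨i.1, rfl⟩).1
    have h2 := ((mo₂ _).1 ⟨j.1, rfl⟩).1
    exact hS' h1 (h ▸ h2)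
  · ext v
    constructor
    · rintro ⟨i | i, rfl⟩
      · have h1 := (mi₁ _).1 ⟨i.1, rfl⟩
        have h2 := (ni₁ i.1).1 i.2
        exact ⟨.inl h1.1, fun h => h.elim h1.2 fun h => h2 ⟨h1.1, h⟩⟩
      · have h1 := (mi₂ _).1 ⟨i.1, rfl⟩
        have h2 := (ni₂ i.1).1 i.2
        exact ⟨.inr h1.1, fun h => h.elim (fun h => h2 ⟨h, h1.1⟩) h1.2⟩
    · rintro ⟨h1 | h1, h2⟩
      · obtain ⟨i, rfl⟩ := (mi₁ v).2 ⟨h1, fun h => h2 (.inl h)⟩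
        exact ⟨.inl ⟨i, (ni₁ i).2 fun h => h2 (.inr h.2)⟩, rfl⟩
      · obtain ⟨i, rfl⟩ := (mi₂ v).2 ⟨h1, fun h => h2 (.inr h)⟩
        exact ⟨.inr ⟨i, (ni₂ i).2 fun h => h2 (.inl h.1)⟩, rfl⟩
  · ext v
    constructor
    · rintro ⟨i | i, rfl⟩
      · have h1 := (mo₁ _).1 ⟨i.1, rfl⟩
        have h2 := (no₁ i.1).1 i.2
        exact ⟨.inl h1.1, fun h => h.elim h1.2 fun h => h2 ⟨h1.1, h⟩⟩
      · have h1 := (mo₂ _).1 ⟨i.1, rfl⟩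
        have h2 := (no₂ i.1).1 i.2
        exact ⟨.inr h1.1, fun h => h.elim (fun h => h2 ⟨h, h1.1⟩) h1.2⟩
    · rintro ⟨h1 | h1, h2⟩
      · obtain ⟨i, rfl⟩ := (mo₁ v).2 ⟨h1, fun h => h2 (.inl h)⟩
        exact ⟨.inl ⟨i, (no₁ i).2 fun h => h2 (.inr h.2)⟩, rfl⟩
      · obtain ⟨i, rfl⟩ := (mo₂ v).2 ⟨h1, fun h => h2 (.inr h)⟩
        exact ⟨.inr ⟨i, (no₂ i).2 fun h => h2 (.inl h.1)⟩, rfl⟩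
  · rintro q t ht (i | i) c
    · exact r₁.trace_inp q t ht i.1 c
    · exact r₂.trace_inp q t ht i.1 c
  · rintro q t ht (i | i) c
    · exact r₁.trace_out q t ht i.1 c
    · exact r₂.trace_out q t ht i.1 c
  · intro q
    simp only [r₁.orbit_last, r₂.orbit_last]
    rfl
  · intro q q' h v hv
    have h1 := congrArg (glueRestrict₁ (Y₁.dowelFst σ₁ τ₁) (Y₂.dowelSnd σ₂ τ₂)) h
    have h2 := congrArg (glueRestrict₂ (Y₁.dowelFst σ₁ τ₁) (Y₂.dowelSnd σ₂ τ₂)) h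
    have hagree : ∀ q d, r₁.orbit q 0 (Y₁.dowelFst σ₁ τ₁ d) =
        r₂.orbit q 0 (Y₂.dowelSnd σ₂ τ₂ d) := by
      rintro q ((⟨a, c⟩ | ⟨b, c⟩) | (⟨a, c⟩ | ⟨b, c⟩))
      · exact hA q 0 (Nat.zero_le _) a _
      · exact hB q 0 (Nat.zero_le _) b _
      · exact hA q 0 (Nat.zero_le _) a _
      · exact hB q 0 (Nat.zero_le _) b _
    rcases hv with hv | hv
    · erw [glueRestrict₁_glueConfig, glueRestrict₁_glueConfig] at h1
      exact r₁.orbit_zero_injective q q' h1 v hv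
    · erw [glueRestrict₂_glueConfig (hagree q), glueRestrict₂_glueConfig (hagree q')] at h2
      exact r₂.orbit_zero_injective q q' h2 v hv

/-- A coherent gadget for a gate of the wiring realizes this gate. -/
theorem nonempty_realization_gate {X : ∀ g : 𝓖, Gadget R Ci Co (Fin g.1.arity) (Fin g.1.coarity)}
    {state : Q → Ci ⊕ Co → R} {context : ∀ g : 𝓖, {v : (X g).V // ¬ (X g).IsInterface v} → R}
    {T : ℕ} {trace : Q → Q → ℕ → Ci ⊕ Co → R} (hstate : Function.Injective state)
    (htrace : ∀ q q', trace q q' 0 = state q ∧ trace q q' T = state q')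
    (hX : ∀ (g : 𝓖) (qi qi' : Fin g.1.arity → Q) (qo qo' : Fin g.1.coarity → Q),
      g.1.map qi = qo' →
      ∃ x : ℕ → (X g).V → R,
        (X g).net.IsPseudoOrbit (X g).dangling T x ∧
        (∀ t ≤ T, ∀ k c, x t ((X g).inp k c) = trace (qi k) (qi' k) t c) ∧
        (∀ t ≤ T, ∀ k c, x t ((X g).out k c) = trace (qo k) (qo' k) t c) ∧
        (∀ v, x 0 v.1 = context g v ∧ x T v.1 = context g v))
    (j : Fin W.numGates) :
    Nonempty (W.Realization {j} T trace (X ⟨W.gate j, W.gate_mem j⟩)) := by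
  let inp : Fin (W.gate j).arity → V := fun k => W.inputs ⟨j, k⟩
  let out : Fin (W.gate j).coarity → V := fun k => W.outputs.symm ⟨j, k⟩
  have hmap : ∀ q : V → Q, (W.gate j).map (fun k => q (inp k)) = fun k => W.network q (out k) := by
    intro q
    funext k
    simp only [inp, out, network_apply]
    rw [Equiv.apply_symm_apply]
  -- The gate only relates current inputs to next outputs. The next inputs and current outputs are
  -- free in the definition of coherence and are set to what the whole network prescribes.
  choose x hx hinp hout hctx using fun q : V → Q => hX ⟨W.gate j, W.gate_mem j⟩
    (fun k => q (inp k)) (fun k => W.network q (inp k)) (fun k => q (out k))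
    (fun k => W.network q (out k)) (hmap q)
  refine ⟨{
    inp := inp
    out := out
    orbit := x
    inp_injective := fun k l h => by simpa [inp] using h
    out_injective := fun k l h => by simpa [out] using h
    range_inp := ?_
    range_out := ?_
    isPseudoOrbit := hx
    trace_inp := hinp
    trace_out := hout
    orbit_last := ?_
    orbit_zero_injective := ?_ }⟩
  · ext v
    obtain ⟨⟨i, k⟩, rfl⟩ := W.inputs.surjective v
    -- Without self-loops every wire of a single gate is on its boundary.
    have hns : W.source (W.inputs ⟨i, k⟩) ≠ i := W.no_self_loop ⟨i, k⟩
    simp only [target, Equiv.symm_apply_apply, Set.mem_singleton_iff, Set.mem_ofPred_eq]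
    constructor
    · rintro ⟨l, hl⟩
      obtain rfl : j = i := congrArg Sigma.fst (W.inputs.injective hl)
      exact ⟨rfl, hns⟩
    · rintro ⟨rfl, -⟩
      exact ⟨k, rfl⟩
  · ext v
    obtain ⟨⟨i, k⟩, rfl⟩ := W.outputs.symm.surjective v
    have hns : W.target (W.outputs.symm ⟨i, k⟩) ≠ i := fun h =>
      W.no_self_loop (W.inputs.symm (W.outputs.symm ⟨i, k⟩)) (by simpa [target] using h.symm)
    simp only [source, Equiv.apply_symm_apply, Set.mem_singleton_iff, Set.mem_ofPred_eq]
    constructor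
    · rintro ⟨l, hl⟩
      obtain rfl : j = i := congrArg Sigma.fst (W.outputs.symm.injective hl)
      exact ⟨rfl, hns⟩
    · rintro ⟨rfl, -⟩
      exact ⟨k, rfl⟩
  · intro q
    funext v
    -- At time T interface copies hold the codes of the next states and all other nodes are back in
    -- the context, exactly as at time 0 for the next configuration.
    by_cases hv : (X ⟨W.gate j, W.gate_mem j⟩).IsInterface v
    · rcases hv with ⟨k, c, rfl⟩ | ⟨k, c, rfl⟩
      · rw [hinp q T le_rfl, hinp _ 0 (Nat.zero_le _), (htrace _ _).1, (htrace _ _).2]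
      · rw [hout q T le_rfl, hout _ 0 (Nat.zero_le _), (htrace _ _).1, (htrace _ _).2]
    · exact (hctx q ⟨v, hv⟩).2.trans (hctx _ ⟨v, hv⟩).1.symm
  · intro q q' h v hv
    obtain ⟨⟨i, k⟩, rfl⟩ := W.outputs.symm.surjective v
    simp only [source, Equiv.apply_symm_apply, Set.mem_singleton_iff] at hv
    subst hv
    refine hstate (funext fun c => ?_)
    rw [← (htrace (q (out k)) (W.network q (out k))).1,
      ← (htrace (q' (out k)) (W.network q' (out k))).1, ← hout q 0 (Nat.zero_le _),
      ← hout q' 0 (Nat.zero_le _), h]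

/-- A gadget of the closure that realizes a nonempty set of gates of a wiring. -/
theorem exists_realization {X : ∀ g : 𝓖, Gadget R Ci Co (Fin g.1.arity) (Fin g.1.coarity)}
    {T : ℕ} {trace : Q → Q → ℕ → Ci ⊕ Co → R} {K : ℕ} (hK : ∀ g, Nat.card (X g).V ≤ K)
    (hgate : ∀ j, Nonempty (W.Realization {j} T trace (X ⟨W.gate j, W.gate_mem j⟩)))
    (S : Finset (Fin W.numGates)) (hS : S.Nonempty) :
    ∃ (I O : Type) (Y : Gadget R Ci Co I O), GadgetClosure X Y ∧ Nat.card Y.V ≤ K * S.card ∧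
      Nonempty (W.Realization (S : Set (Fin W.numGates)) T trace Y) := by
  induction hS using Finset.Nonempty.cons_induction with
  | singleton j =>
    exact ⟨_, _, _, .base ⟨W.gate j, W.gate_mem j⟩, by simpa using hK _, by simpa using hgate j⟩
  | cons j S hj hS ih =>
    obtain ⟨I, O, Y, hY, hcard, ⟨r⟩⟩ := ih
    obtain ⟨rj⟩ := hgate j
    have hdisj : Disjoint {j} (S : Set (Fin W.numGates)) := by simpa using hj
    -- Gates that share no wire are covered too: `A` and `B` may be empty.
    obtain ⟨A, B, σ₁, σ₂, τ₁, τ₂, hr⟩ := rj.exists_glueing hdisj r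
    refine ⟨_, _, _, .glueing σ₁ σ₂ τ₁ τ₂ (.base _) hY, ?_, by simpa using hr⟩
    have := (X ⟨W.gate j, W.gate_mem j⟩).finite
    have := Y.finite
    refine (card_glueNodes_le (Gadget.dowelFst_injective _ _ _)).trans ?_
    rw [Finset.card_cons, Nat.mul_succ, add_comm]
    exact Nat.add_le_add hcard (hK _)

end Wiring

theorem Network.rename_iterate {Q V W : Type} (e : V ≃ W) (F : Network Q V) (t : ℕ) (x : V → Q) :
    (F.rename e)^[t] (fun w => x (e.symm w)) = fun w => F^[t] x (e.symm w) := by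
  induction t generalizing x with
  | zero => rfl
  | succ t ih =>
    rw [Function.iterate_succ_apply, Function.iterate_succ_apply, ← ih]
    congr 1
    funext w
    simp [Network.rename]

/-- A family with coherent gadgets for a finite set of gates simulates the networks of these gates in
constant time and linear space. -/
theorem HasCoherentGadgets.exists_simulation {Q R : Type} [Nontrivial Q] {𝓖 : Set (Gate Q)}
    (h𝓖 : 𝓖.Finite) {𝓕 : NetworkFamily R} (h : HasCoherentGadgets 𝓖 𝓕) :
    ∃ K T : ℕ, 0 < T ∧ ∀ {V : Type} (W : Wiring 𝓖 V), 0 < W.numGates →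
      ∃ m ≤ K * W.numGates, ∃ G ∈ 𝓕 m, ∃ Φ : (V → Q) → Fin m → R,
        Function.Injective Φ ∧ ∀ q, Φ (W.network q) = G^[T] (Φ q) := by
  obtain ⟨Ci, Co, X, state, context, T, trace, hclosure, hstate, htrace, hX⟩ := h
  have := h𝓖.to_subtype
  obtain ⟨K, hK⟩ : ∃ K, ∀ g, Nat.card (X g).V ≤ K := by
    obtain ⟨K, hK⟩ := (Set.finite_range fun g => Nat.card (X g).V).bddAbove
    exact ⟨K, fun g => hK ⟨g, rfl⟩⟩
  -- If T were 0, one trace would start and end at the codes of two distinct states at the same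
  -- time.
  have hT : 0 < T := by
    rcases Nat.eq_zero_or_pos T with rfl | hT
    · obtain ⟨a, b, hab⟩ := exists_pair_ne Q
      exact absurd (hstate ((htrace a b).1.symm.trans (htrace a b).2)) hab
    · exact hT
  refine ⟨K, T, hT, fun {V} W hW => ?_⟩
  have : Nonempty (Fin W.numGates) := ⟨⟨0, hW⟩⟩
  obtain ⟨I, O, Y, hY, hcard, ⟨r⟩⟩ := W.exists_realization hK
    (W.nonempty_realization_gate hstate htrace hX) Finset.univ Finset.univ_nonempty
  obtain ⟨m, e, he⟩ := hclosure Y hY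
  -- The set of all gates has no boundary, so nothing dangles and pseudo-orbits are orbits.
  have hI : IsEmpty I := ⟨fun i => by
    have : r.inp i ∈ Set.range r.inp := ⟨i, rfl⟩
    rw [r.range_inp] at this
    simp at this⟩
  have hO : IsEmpty O := ⟨fun i => by
    have : r.out i ∈ Set.range r.out := ⟨i, rfl⟩
    rw [r.range_out] at this
    simp at this⟩
  have hdang : ∀ v, v ∉ Y.dangling := by
    rintro v (⟨k, -⟩ | ⟨k, -⟩)
    · exact hI.elim k
    · exact hO.elim k
  have horbit : ∀ q, ∀ t ≤ T, r.orbit q t = Y.net^[t] (r.orbit q 0) := by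
    intro q t
    induction t with
    | zero => simp
    | succ t ih =>
      intro ht
      rw [Function.iterate_succ_apply', ← ih (by omega)]
      exact funext fun v => r.isPseudoOrbit q t ht v (hdang v)
  refine ⟨m, ?_, Y.net.rename e, he, fun q w => r.orbit q 0 (e.symm w), ?_, ?_⟩
  · rw [Nat.card_congr e] at hcard
    simpa using hcard
  · intro q q' hqq
    refine funext fun v => r.orbit_zero_injective q q' (funext fun w => ?_) v (by simp)
    simpa using congrFun hqq (e w)
  · intro q
    rw [Network.rename_iterate, ← horbit q T le_rfl, r.orbit_last]

/-! ### Super-polynomial transients -/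

/-- A limit configuration is the image of some z after as many steps as there are configurations; by
then the orbit of z has repeated a value and has entered its cycle. -/
theorem Network.limitSet_subset_periodicPts {Q V : Type} [Finite Q] [Finite V]
    (F : Network Q V) : F.limitSet ⊆ Function.periodicPts F := by
  intro y hy
  obtain ⟨z, hz⟩ := Set.mem_iInter.1 hy (Nat.card (V → Q))
  have hninj : ¬ Function.Injective fun i : Fin (Nat.card (V → Q) + 1) => F^[i] z := fun h => by
    have := Nat.card_le_card_of_injective _ h
    simp at this
  obtain ⟨i, j, hij, hlt⟩ : ∃ i j : Fin (Nat.card (V → Q) + 1), F^[i] z = F^[j] z ∧ i < j := by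
    simp only [Function.Injective, not_forall] at hninj
    obtain ⟨i, j, h, hne⟩ := hninj
    rcases lt_or_gt_of_ne hne with hlt | hlt
    · exact ⟨i, j, h, hlt⟩
    · exact ⟨j, i, h.symm, hlt⟩
  have hlt' : (i : ℕ) < j := hlt
  have hi := i.2
  refine ⟨j - i, by omega, ?_⟩
  rw [Function.IsPeriodicPt, Function.IsFixedPt, ← hz, ← Function.iterate_add_apply,
    show (j : ℕ) - i + Nat.card (V → Q) = Nat.card (V → Q) - i + j by omega,
    Function.iterate_add_apply, ← hij, ← Function.iterate_add_apply]
  congr 2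
  omega

namespace Wiring

variable {Q V J : Type} {𝓖 : Set (Gate Q)}

/-- A wiring given by the input and the output of a gate to which each node belongs. -/
noncomputable def ofSlots [Finite J] (gate : J → Gate Q) (hgate : ∀ j, gate j ∈ 𝓖)
    (reader : V ≃ Σ j, Fin (gate j).arity) (writer : V ≃ Σ j, Fin (gate j).coarity)
    (hne : ∀ v, (writer v).1 ≠ (reader v).1) : Wiring 𝓖 V where
  numGates := Nat.card J
  gate i := gate ((Finite.equivFin J).symm i)
  gate_mem i := hgate _
  inputs := (Equiv.sigmaCongrLeft (β := fun j => Fin (gate j).arity)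
    (Finite.equivFin J).symm).trans reader.symm
  outputs := writer.trans (Equiv.sigmaCongrLeft (β := fun j => Fin (gate j).coarity)
    (Finite.equivFin J).symm).symm
  no_self_loop p := by
    obtain ⟨v, rfl⟩ := ((Equiv.sigmaCongrLeft (β := fun j => Fin (gate j).arity)
      (Finite.equivFin J).symm).trans reader.symm).symm.surjective p
    intro h
    rw [Equiv.apply_symm_apply] at h
    have h' := congrArg (Finite.equivFin J).symm h
    refine hne v ?_
    have e1 : ∀ s, (Finite.equivFin J).symm ((Equiv.sigmaCongrLeft
        (β := fun j => Fin (gate j).coarity) (Finite.equivFin J).symm).symm s).1 = s.1 := by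
      intro s
      exact congrArg Sigma.fst (Equiv.apply_symm_apply (Equiv.sigmaCongrLeft
        (β := fun j => Fin (gate j).coarity) (Finite.equivFin J).symm) s)
    have e2 : ∀ s, (Finite.equivFin J).symm ((Equiv.sigmaCongrLeft
        (β := fun j => Fin (gate j).arity) (Finite.equivFin J).symm).symm s).1 = s.1 := by
      intro s
      exact congrArg Sigma.fst (Equiv.apply_symm_apply (Equiv.sigmaCongrLeft
        (β := fun j => Fin (gate j).arity) (Finite.equivFin J).symm) s)
    exact (e1 _).symm.trans (h'.trans (e2 _))

theorem ofSlots_network [Finite J] {gate : J → Gate Q} {hgate : ∀ j, gate j ∈ 𝓖}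
    {reader : V ≃ Σ j, Fin (gate j).arity} {writer : V ≃ Σ j, Fin (gate j).coarity}
    {hne : ∀ v, (writer v).1 ≠ (reader v).1} {v : V} {j : J} {o : Fin (gate j).coarity}
    (hv : writer v = ⟨j, o⟩) (x : V → Q) :
    (ofSlots gate hgate reader writer hne).network x v =
      (gate j).map (fun k => x (reader.symm ⟨j, k⟩)) o := by
  obtain ⟨p, hp⟩ : ∃ p, (Equiv.sigmaCongrLeft (β := fun j => Fin (gate j).coarity)
      (Finite.equivFin J).symm) p = writer v := Equiv.surjective _ _
  have hout : (ofSlots gate hgate reader writer hne).outputs v = p :=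
    (Equiv.symm_apply_eq _).2 hp.symm
  rw [network_apply, hout]
  have hp' : (⟨(Finite.equivFin J).symm p.1, p.2⟩ : Σ j, Fin (gate j).coarity) = ⟨j, o⟩ :=
    hp.trans hv
  -- Stated for arbitrary pairs so that the equality of dependent pairs can be substituted.
  have key : ∀ s s' : Σ j, Fin (gate j).coarity, s = s' →
      (gate s.1).map (fun k => x (reader.symm ⟨s.1, k⟩)) s.2 =
        (gate s'.1).map (fun k => x (reader.symm ⟨s'.1, k⟩)) s'.2 := by
    rintro s _ rfl; rfl
  exact key _ _ hp'

/-- A wiring with renamed nodes. -/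
def rename {W : Type} (e : V ≃ W) (w : Wiring 𝓖 V) : Wiring 𝓖 W where
  numGates := w.numGates
  gate := w.gate
  gate_mem := w.gate_mem
  inputs := w.inputs.trans e
  outputs := e.symm.trans w.outputs
  no_self_loop p := by simpa using w.no_self_loop p

theorem rename_network {W : Type} (e : V ≃ W) (w : Wiring 𝓖 V) :
    (w.rename e).network = w.network.rename e := rfl

theorem numGates_le_card [Finite V] (W : Wiring 𝓖 V) (h : ∀ g ∈ 𝓖, 0 < g.coarity) :
    W.numGates ≤ Nat.card V := by
  have := Nat.card_le_card_of_injective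
    (fun j : Fin W.numGates => W.outputs.symm ⟨j, ⟨0, h _ (W.gate_mem j)⟩⟩)
    (fun i j hij => congrArg Sigma.fst (W.outputs.symm.injective hij))
  simpa using this

end Wiring

theorem gatesT_coarity_pos : ∀ g ∈ gatesT, 0 < g.coarity := by
  intro g hg
  simp only [gatesT, Set.mem_insert_iff, Set.mem_singleton_iff] at hg
  rcases hg with rfl | rfl | rfl | rfl | rfl <;> simp [gateAnd01, gateAnd2, gateLambda, gateId,
    gateCopy]

theorem gatesT_finite : gatesT.Finite := by
  unfold gatesT
  exact Set.toFinite _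

/-! ### A network that waits for the coincidence of `k` clocks -/

namespace Clock

/-- The gates: a loop with constant value `1` until `gateLambda` reads a `2`; for `i < k` a cycle of
length `i + 2` of which a copy is tapped; a chain of conjunctions of the tapped values; and a gate
that turns the result into a `2`. -/
inductive Gates (k : ℕ) : Type
  | loop
  | loopCopy
  | lastCopy
  | detect
  | conj (i : Fin k)
  | tapCopy (i : Fin k)
  | shift (i : Fin k) (j : Fin (i + 1))

/-- The two `test` nodes duplicate the end of the chain, because AND₂ needs both of its inputs equal
to 1 to create a 2. -/
inductive Nodes (k : ℕ) : Type
  | loop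
  | loopBack
  | alarm
  | test (b : Fin 2)
  | chain (i : Fin (k + 1))
  | tap (i : Fin k)
  | cell (i : Fin k) (j : Fin (i + 1 + 1))

variable {k : ℕ}

def gate : Gates k → Gate (Fin 3)
  | .loop => gateLambda
  | .loopCopy => gateCopy
  | .lastCopy => gateCopy
  | .detect => gateAnd2
  | .conj _ => gateAnd01
  | .tapCopy _ => gateCopy
  | .shift _ _ => gateId

theorem gate_mem (g : Gates k) : gate g ∈ gatesT := by
  cases g <;> simp [gate, gatesT]

/-- The last node of the chain and of each cycle is read by a copy gate instead of a conjunction or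
a shift; dually, `writer` singles out the first node. -/
def reader : Nodes k → Σ g : Gates k, Fin (gate g).arity
  | .loop => ⟨.loopCopy, (0 : Fin 1)⟩
  | .loopBack => ⟨.loop, (0 : Fin 2)⟩
  | .alarm => ⟨.loop, (1 : Fin 2)⟩
  | .test b => ⟨.detect, b⟩
  | .chain i => Fin.lastCases ⟨.lastCopy, (0 : Fin 1)⟩ (fun i => ⟨.conj i, (0 : Fin 2)⟩) i
  | .tap i => ⟨.conj i, (1 : Fin 2)⟩
  | .cell i j => Fin.lastCases ⟨.tapCopy i, (0 : Fin 1)⟩ (fun j => ⟨.shift i j, (0 : Fin 1)⟩) j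

def writer : Nodes k → Σ g : Gates k, Fin (gate g).coarity
  | .loop => ⟨.loop, (0 : Fin 1)⟩
  | .loopBack => ⟨.loopCopy, (0 : Fin 2)⟩
  | .alarm => ⟨.detect, (0 : Fin 1)⟩
  | .test b => ⟨.lastCopy, b⟩
  | .chain i => Fin.cases ⟨.loopCopy, (1 : Fin 2)⟩ (fun i => ⟨.conj i, (0 : Fin 1)⟩) i
  | .tap i => ⟨.tapCopy i, (1 : Fin 2)⟩
  | .cell i j => Fin.cases ⟨.tapCopy i, (0 : Fin 2)⟩ (fun j => ⟨.shift i j, (0 : Fin 1)⟩) j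

/-- The node read by an input of a gate. -/
def read : (Σ g : Gates k, Fin (gate g).arity) → Nodes k
  | ⟨.loop, b⟩ => if b.1 = 0 then .loopBack else .alarm
  | ⟨.loopCopy, _⟩ => .loop
  | ⟨.lastCopy, _⟩ => .chain (Fin.last k)
  | ⟨.detect, b⟩ => .test b
  | ⟨.conj i, b⟩ => if b.1 = 0 then .chain i.castSucc else .tap i
  | ⟨.tapCopy i, _⟩ => .cell i (Fin.last _)
  | ⟨.shift i j, _⟩ => .cell i j.castSucc

/-- The node written by an output of a gate. -/
def write : (Σ g : Gates k, Fin (gate g).coarity) → Nodes k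
  | ⟨.loop, _⟩ => .loop
  | ⟨.loopCopy, b⟩ => if b.1 = 0 then .loopBack else .chain 0
  | ⟨.lastCopy, b⟩ => .test b
  | ⟨.detect, _⟩ => .alarm
  | ⟨.conj i, _⟩ => .chain i.succ
  | ⟨.tapCopy i, b⟩ => if b.1 = 0 then .cell i 0 else .tap i
  | ⟨.shift i j, _⟩ => .cell i j.succ

def readerEquiv : Nodes k ≃ Σ g : Gates k, Fin (gate g).arity where
  toFun := reader
  invFun := read
  left_inv v := by
    rcases v with _ | _ | _ | b | i | i | ⟨i, j⟩
    all_goals try rfl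
    · refine Fin.lastCases ?_ (fun i => ?_) i <;> simp [reader, read]
    · refine Fin.lastCases ?_ (fun j => ?_) j <;> simp [reader, read]
  right_inv p := by
    obtain ⟨_ | _ | _ | _ | i | i | ⟨i, j⟩, b⟩ := p
    · change Fin 2 at b
      fin_cases b <;> rfl
    · change Fin 1 at b
      fin_cases b; rfl
    · change Fin 1 at b
      fin_cases b; simp [reader, read]
    · rfl
    · change Fin 2 at b
      fin_cases b <;> simp [reader, read]
    · change Fin 1 at b
      fin_cases b; simp [reader, read]
    · change Fin 1 at b
      fin_cases b; simp [reader, read]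

def writerEquiv : Nodes k ≃ Σ g : Gates k, Fin (gate g).coarity where
  toFun := writer
  invFun := write
  left_inv v := by
    rcases v with _ | _ | _ | b | i | i | ⟨i, j⟩
    all_goals try rfl
    · refine Fin.cases ?_ (fun i => ?_) i <;> simp [writer, write]
    · refine Fin.cases ?_ (fun j => ?_) j <;> simp [writer, write]
  right_inv p := by
    obtain ⟨_ | _ | _ | _ | i | i | ⟨i, j⟩, b⟩ := p
    · change Fin 1 at b
      fin_cases b; rfl
    · change Fin 2 at b
      fin_cases b <;> rfl
    · rfl
    · change Fin 1 at b
      fin_cases b; rfl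
    · change Fin 1 at b
      fin_cases b; rfl
    · change Fin 2 at b
      fin_cases b <;> rfl
    · change Fin 1 at b
      fin_cases b; rfl

/-- Self-loops are avoided because the clock cycles have length at least 2 and the constant loop
passes through two gates. -/
theorem write_ne_read (g : Gates k) (o : Fin (gate g).coarity) (o' : Fin (gate g).arity) :
    write ⟨g, o⟩ ≠ read ⟨g, o'⟩ := by
  rcases g with _ | _ | _ | _ | i | i | ⟨i, j⟩ <;> simp only [write, read] <;>
    try split_ifs
  all_goals simp [Fin.ext_iff]

theorem writer_ne_reader (v : Nodes k) : (writerEquiv v).1 ≠ (readerEquiv v).1 := by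
  intro h
  obtain ⟨⟨g, o⟩, rfl⟩ := writerEquiv.symm.surjective v
  obtain ⟨⟨g', o'⟩, h'⟩ := readerEquiv.symm.surjective (writerEquiv.symm ⟨g, o⟩)
  rw [← h', Equiv.apply_symm_apply, h', Equiv.apply_symm_apply] at h
  obtain rfl : g = g' := h
  exact write_ne_read g o o' h'.symm

theorem card_nodes_le : Finite (Nodes k) ∧ Nat.card (Nodes k) ≤ 7 * ((k + 2) * (k + 2)) := by
  let f : Nodes k → Fin 7 × Fin (k + 2) × Fin (k + 2) := fun v => match v with
    | .loop => (0, 0, 0)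
    | .loopBack => (1, 0, 0)
    | .alarm => (2, 0, 0)
    | .test b => (3, b.castLE (by omega), 0)
    | .chain i => (4, i.castSucc, 0)
    | .tap i => (5, i.castSucc.castSucc, 0)
    | .cell i j => (6, i.castSucc.castSucc, j.castLE (by omega))
  have hf : Function.Injective f := by
    rintro (_ | _ | _ | b | i | i | ⟨i, j⟩) (_ | _ | _ | b' | i' | i' | ⟨i', j'⟩) h <;>
      simp [f] at h
    all_goals try rfl
    · rw [h]
    · rw [h]
    · rw [h]
    · obtain ⟨rfl, h⟩ := h
      simpa using h
  exact ⟨Finite.of_injective f hf, by simpa using Nat.card_le_card_of_injective f hf⟩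

instance : Finite (Nodes k) := card_nodes_le.1

instance : Finite (Gates k) := by
  have hpos : ∀ g : Gates k, 0 < (gate g).coarity := fun g => gatesT_coarity_pos _ (gate_mem g)
  exact Finite.of_injective (fun g => writerEquiv.symm ⟨g, ⟨0, hpos g⟩⟩)
    fun g g' h => congrArg Sigma.fst (writerEquiv.symm.injective h)

/-- The wiring of the network. -/
noncomputable def wiring (k : ℕ) : Wiring gatesT (Nodes k) :=
  Wiring.ofSlots gate gate_mem readerEquiv writerEquiv writer_ne_reader

theorem network_write (x : Nodes k → Fin 3) (g : Gates k) (o : Fin (gate g).coarity) :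
    (wiring k).network x (write ⟨g, o⟩) = (gate g).map (fun b => x (read ⟨g, b⟩)) o :=
  Wiring.ofSlots_network (writerEquiv.apply_symm_apply ⟨g, o⟩) x

section Dynamics

variable (x : Nodes k → Fin 3)

theorem network_loop : (wiring k).network x .loop =
    if x .loopBack = 2 ∨ x .alarm = 2 then 2 else x .loopBack :=
  network_write x .loop (0 : Fin 1)

theorem network_loopBack : (wiring k).network x .loopBack = x .loop :=
  network_write x .loopCopy (0 : Fin 2)

theorem network_alarm : (wiring k).network x .alarm =
    if x (.test 0) = 2 ∨ x (.test 1) = 2 ∨ (x (.test 0) = 1 ∧ x (.test 1) = 1) then 2 else 0 :=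
  network_write x .detect (0 : Fin 1)

theorem network_test (b : Fin 2) : (wiring k).network x (.test b) = x (.chain (Fin.last k)) :=
  network_write x .lastCopy b

theorem network_chain_zero : (wiring k).network x (.chain 0) = x .loop :=
  network_write x .loopCopy (1 : Fin 2)

theorem network_chain_succ (i : Fin k) : (wiring k).network x (.chain i.succ) =
    if x (.chain i.castSucc) = 2 ∨ x (.tap i) = 2 then 2
    else min (x (.chain i.castSucc)) (x (.tap i)) :=
  network_write x (.conj i) (0 : Fin 1)

theorem network_tap (i : Fin k) : (wiring k).network x (.tap i) = x (.cell i (Fin.last _)) :=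
  network_write x (.tapCopy i) (1 : Fin 2)

theorem network_cell_zero (i : Fin k) :
    (wiring k).network x (.cell i 0) = x (.cell i (Fin.last _)) :=
  network_write x (.tapCopy i) (0 : Fin 2)

theorem network_cell_succ (i : Fin k) (j : Fin (i + 1)) :
    (wiring k).network x (.cell i j.succ) = x (.cell i j.castSucc) :=
  network_write x (.shift i j) (0 : Fin 1)

end Dynamics

open Classical in
/-- The configuration at time `t`, as long as no `2` was read by the loop. -/
noncomputable def config (k t : ℕ) : Nodes k → Fin 3
  | .loop => 1
  | .loopBack => 1
  | .alarm => if ∀ i < k, i + 2 ∣ t + 1 then 2 else 0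
  | .test _ => if ∀ i < k, i + 2 ∣ t + 2 then 1 else 0
  -- The phases compensate the delays: the i-th clock joins the chain k - i steps before its end, so
  -- that all conditions reach `alarm` as divisibility of t + 1. Integers avoid truncated
  -- subtraction.
  | .chain c => if ∀ i < c.1, ((i : ℤ) + 2) ∣ t + k + 3 - c then 1 else 0
  | .tap i => if ((i : ℤ) + 2) ∣ t + k + 3 - i then 1 else 0
  | .cell i j => if ((i : ℤ) + 2) ∣ t + k + 3 - i - j then 1 else 0

theorem ite_bit_ne_two (p : Prop) [Decidable p] : (if p then 1 else 0 : Fin 3) ≠ 2 := by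
  split_ifs <;> decide

theorem network_config {t : ℕ} (h : ¬ ∀ i < k, i + 2 ∣ t + 1) :
    (wiring k).network (config k t) = config k (t + 1) := by
  funext v
  rcases v with _ | _ | _ | b | c | i | ⟨i, j⟩
  · rw [network_loop]
    simp [config, h]
  · rw [network_loopBack]
    rfl
  · rw [network_alarm]
    simp only [config, ite_bit_ne_two, false_or]
    by_cases h : ∀ i < k, i + 2 ∣ t + 2
    · have h' : ∀ i < k, i + 2 ∣ t + 1 + 1 := h
      simp only [if_pos h]
      rfl
    · have h' : ¬ ∀ i < k, i + 2 ∣ t + 1 + 1 := h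
      simp only [if_neg h]
      rfl
  · rw [network_test]
    simp only [config, Fin.val_last]
    congr 1
    refine propext (forall₂_congr fun i hi => ?_)
    rw [show ((t : ℤ) + k + 3 - k) = ((t + 1 + 2 : ℕ) : ℤ) by push_cast; ring,
      show ((i : ℤ) + 2) = ((i + 2 : ℕ) : ℤ) by push_cast; ring, Int.natCast_dvd_natCast]
  · refine Fin.cases ?_ (fun i => ?_) c
    · rw [network_chain_zero]
      simp [config]
    · rw [network_chain_succ]
      simp only [config, ite_bit_ne_two, or_self, if_false, Fin.val_castSucc, Fin.val_succ]
      have h1 : (∀ i' < (i : ℕ) + 1, ((i' : ℤ) + 2) ∣ ((t + 1 : ℕ) : ℤ) + k + 3 - ((i + 1 : ℕ) : ℤ)) ↔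
          (∀ i' < (i : ℕ), ((i' : ℤ) + 2) ∣ t + k + 3 - i) ∧ ((i : ℤ) + 2) ∣ t + k + 3 - i := by
        have h2 : (((t + 1 : ℕ) : ℤ) + k + 3 - ((i + 1 : ℕ) : ℤ)) = t + k + 3 - i := by
          push_cast; ring
        rw [h2]
        constructor
        · exact fun h => ⟨fun i' hi' => h i' (by omega), h i (by omega)⟩
        · rintro ⟨h, h'⟩ i' hi'
          rcases Nat.lt_succ_iff_lt_or_eq.1 hi' with hi' | rfl
          · exact h i' hi'
          · exact h'
      simp only [h1]
      by_cases h3 : ∀ i' < (i : ℕ), ((i' : ℤ) + 2) ∣ t + k + 3 - i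
      · by_cases h4 : ((i : ℤ) + 2) ∣ t + k + 3 - i
        · simp only [if_pos h3, if_pos h4, if_pos (And.intro h3 h4)]; rfl
        · simp only [if_pos h3, if_neg h4, if_neg fun h : _ ∧ _ => h4 h.2]; rfl
      · simp only [if_neg h3, if_neg fun h : _ ∧ _ => h3 h.1]
        exact min_eq_left (Fin.zero_le _)
  · rw [network_tap]
    simp only [config, Fin.val_last]
    congr 1
    -- Closing the cycle changes the argument by its length i + 2, which does not affect
    -- divisibility by i + 2.
    rw [show ((t + 1 : ℕ) : ℤ) + k + 3 - i = t + k + 3 - i - ((i + 1 : ℕ) : ℤ) + (i + 2) by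
      push_cast; ring, dvd_add_self_right]
  · refine Fin.cases ?_ (fun j => ?_) j
    · rw [network_cell_zero]
      simp only [config, Fin.val_last, Fin.val_zero]
      congr 1
      rw [show ((t + 1 : ℕ) : ℤ) + k + 3 - i - ((0 : ℕ) : ℤ) =
        t + k + 3 - i - ((i + 1 : ℕ) : ℤ) + (i + 2) by push_cast; ring, dvd_add_self_right]
    · rw [network_cell_succ]
      simp only [config, Fin.val_castSucc, Fin.val_succ]
      congr 2
      push_cast; ring

theorem forall_dvd_iff (k s : ℕ) : (∀ i < k, i + 2 ∣ s) ↔ Nat.lcmUpto (k + 1) ∣ s := by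
  rw [Nat.lcmUpto, Finset.lcm_dvd_iff]
  simp only [Finset.mem_Icc, id, and_imp]
  constructor
  · intro h b hb1 hbk
    rcases Nat.lt_or_ge b 2 with hb | hb
    · obtain rfl : b = 1 := by omega
      exact one_dvd _
    · simpa [hb] using h (b - 2) (by omega)
  · exact fun h i hi => h (i + 2) (by omega) (by omega)

theorem iterate_config (k : ℕ) {t : ℕ} (ht : t < Nat.lcmUpto (k + 1)) :
    (wiring k).network^[t] (config k 0) = config k t := by
  induction t with
  | zero => rfl
  | succ t ih =>
    rw [Function.iterate_succ_apply', ih (by omega), network_config]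
    rw [forall_dvd_iff]
    exact fun h => absurd (Nat.le_of_dvd (by omega) h) (by omega)

/-- At this time the alarm is 2, so the next step puts a 2 in the loop. It then alternates between
`loop` and `loopBack` forever, whereas both hold 1 in the configuration considered. -/
theorem config_notMem_periodicPts (k : ℕ) :
    config k (Nat.lcmUpto (k + 1) - 1) ∉ Function.periodicPts (wiring k).network := by
  set y := config k (Nat.lcmUpto (k + 1) - 1) with hy
  have halarm : y .alarm = 2 := by
    have h := (forall_dvd_iff k (Nat.lcmUpto (k + 1) - 1 + 1)).2
      (by rw [Nat.sub_add_cancel (Nat.lcmUpto_pos _)])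
    simp only [hy, config]
    rw [if_pos h]
  have key : ∀ n, (wiring k).network^[n + 1] y .loop = 2 ∨
      (wiring k).network^[n + 1] y .loopBack = 2 := by
    intro n
    induction n with
    | zero =>
      left
      change (wiring k).network y .loop = 2
      rw [network_loop, if_pos (.inr halarm)]
    | succ n ih =>
      rw [Function.iterate_succ_apply', network_loop, network_loopBack]
      rcases ih with h | h
      · exact .inr h
      · exact .inl (if_pos (.inl h))
  rintro ⟨N, hN, hper⟩
  have h := key (N - 1)
  rw [Nat.sub_add_cancel hN, hper.eq] at h
  rcases h with h | h <;> exact absurd h (by simp [hy, config])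

end Clock

/-! ### Growth of the coincidence time and conclusion -/

/-- Let K = k + 1 and L = lcm(1, …, K). From 2^K ≤ (K + 1) L, e^(K/2) ≤ 2^K and K + 1 ≤ 4 e^(K/4)
comes e^(K/4) ≤ 4L, while n^(1/4) ≤ √K ≤ K/4 + 1. The constant 8e collects this 4, a 2 from L ≤ 2(L
- 1), and an e from the last + 1. -/
theorem exp_sqrt_le_lcmUpto {n k : ℕ} (hk : 1 ≤ k) (hn : n ≤ (k + 1) ^ 2) :
    1 / (8 * Real.exp 1) * Real.exp ((n : ℝ) ^ (1 / 4 : ℝ)) ≤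
      ((Nat.lcmUpto (k + 1) - 1 : ℕ) : ℝ) := by
  set K : ℝ := (k : ℝ) + 1 with hK
  have hK0 : 0 ≤ K := by positivity
  have h1 : (n : ℝ) ^ (1 / 4 : ℝ) ≤ K / 4 + 1 := by
    have h2 : (n : ℝ) ≤ K ^ 2 := by rw [hK]; exact_mod_cast hn
    have h3 : (n : ℝ) ^ (1 / 4 : ℝ) ≤ (K ^ 2) ^ (1 / 4 : ℝ) :=
      Real.rpow_le_rpow (by positivity) h2 (by norm_num)
    have h4 : (K ^ 2) ^ (1 / 4 : ℝ) = Real.sqrt K := by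
      rw [Real.sqrt_eq_rpow, ← Real.rpow_natCast, ← Real.rpow_mul hK0]
      norm_num
    rw [h4] at h3
    nlinarith [Real.sq_sqrt hK0, sq_nonneg (Real.sqrt K / 2 - 1)]
  have h2 : K + 1 ≤ 4 * Real.exp (K / 4) := by linarith [Real.add_one_le_exp (K / 4)]
  have h3 : Real.exp (K / 2) ≤ 2 ^ (k + 1) := by
    rw [← Real.exp_log (show (0 : ℝ) < 2 ^ (k + 1) by positivity), Real.exp_le_exp, Real.log_pow]
    push_cast
    nlinarith [Real.log_two_gt_d9]
  have h4 : (2 : ℝ) ^ (k + 1) ≤ (K + 1) * Nat.lcmUpto (k + 1) := by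
    have := Chebyshev.two_pow_le_mul_lcmUpto (k + 1)
    rw [hK]
    exact_mod_cast this
  have hL : 2 ≤ Nat.lcmUpto (k + 1) :=
    Nat.le_of_dvd (Nat.lcmUpto_pos _) (dvd_lcmUpto two_pos (by omega))
  have h5 : (Nat.lcmUpto (k + 1) : ℝ) ≤ 2 * ((Nat.lcmUpto (k + 1) - 1 : ℕ) : ℝ) := by
    exact_mod_cast (by omega : Nat.lcmUpto (k + 1) ≤ 2 * (Nat.lcmUpto (k + 1) - 1))
  have h6 : Real.exp (K / 4) * Real.exp (K / 4) ≤
      4 * Real.exp (K / 4) * Nat.lcmUpto (k + 1) := by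
    rw [← Real.exp_add, show K / 4 + K / 4 = K / 2 by ring]
    exact h3.trans (h4.trans (mul_le_mul_of_nonneg_right h2 (by positivity)))
  have h7 : Real.exp (K / 4) ≤ 4 * Nat.lcmUpto (k + 1) := by
    refine le_of_mul_le_mul_right ?_ (Real.exp_pos (K / 4))
    linarith
  calc 1 / (8 * Real.exp 1) * Real.exp ((n : ℝ) ^ (1 / 4 : ℝ))
      ≤ 1 / (8 * Real.exp 1) * (Real.exp (K / 4) * Real.exp 1) := by
        rw [← Real.exp_add]
        gcongr
    _ = Real.exp (K / 4) / 8 := by field_simp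
    _ ≤ _ := by linarith

/-- Networks of gates with long transients. -/
theorem exists_wiring_long_transient {n : ℕ} (hn : 1 ≤ n) :
    ∃ m ≤ 63 * n, ∃ W : Wiring gatesT (Fin m), 0 < W.numGates ∧ W.numGates ≤ 63 * n ∧
      ∃ (x : Fin m → Fin 3) (t : ℕ),
        1 / (8 * Real.exp 1) * Real.exp ((n : ℝ) ^ (1 / 4 : ℝ)) ≤ t ∧
          W.network^[t] x ∉ Function.periodicPts W.network := by
  set k := Nat.sqrt n with hk
  have hk1 : 1 ≤ k := Nat.le_sqrt.2 (by omega)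
  have hkn : k * k ≤ n := Nat.sqrt_le n
  have hnk : n ≤ (k + 1) ^ 2 := by rw [sq]; exact (Nat.lt_succ_sqrt n).le
  let e := Finite.equivFin (Clock.Nodes k)
  -- The bound 63 is 7 · 9: since k ≥ 1, (k + 2)² ≤ 9k² ≤ 9n.
  let W := (Clock.wiring k).rename e
  have hm : Nat.card (Clock.Nodes k) ≤ 63 * n := Clock.card_nodes_le.2.trans (by nlinarith)
  have hle : W.numGates ≤ Nat.card (Clock.Nodes k) := by
    simpa using W.numGates_le_card gatesT_coarity_pos
  refine ⟨_, hm, W, (W.outputs (e .loop)).1.pos, hle.trans hm,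
    fun w => Clock.config k 0 (e.symm w), Nat.lcmUpto (k + 1) - 1, exp_sqrt_le_lcmUpto hk1 hnk, ?_⟩
  intro hper
  rw [Wiring.rename_network, Network.rename_iterate,
    Clock.iterate_config k (Nat.sub_lt (Nat.lcmUpto_pos _) one_pos)] at hper
  refine Clock.config_notMem_periodicPts k (mem_periodicPts_of_map_step (T := 1)
    (Φ := fun (x : Clock.Nodes k → Fin 3) w => x (e.symm w)) ?_ ?_ hper)
  · intro x y hxy
    funext v
    simpa using congrFun hxy (e v)
  · intro x
    exact (Network.rename_iterate e (Clock.wiring k).network 1 x).symm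

theorem gateNetworks_gatesT_hasSuperpolynomialTransients :
    (gateNetworks gatesT).HasSuperpolynomialTransients := by
  refine ⟨1 / 4, by norm_num, 63, 1 / (8 * Real.exp 1), by positivity, fun n hn => ?_⟩
  obtain ⟨m, hm, W, -, -, x, t, ht, hx⟩ := exists_wiring_long_transient hn
  exact ⟨m, hm, W.network, ⟨W, rfl⟩, x, t, ht,
    fun h => hx (W.network.limitSet_subset_periodicPts h)⟩

/-- The simulation multiplies time by T ≥ 1 and costs a constant number of nodes per gate. If the
image of a configuration were in an attractor it would be periodic, and injectivity would make the
configuration itself periodic. -/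
theorem HasCoherentGadgets.hasSuperpolynomialTransients {R : Type} [Finite R]
    {𝓕 : NetworkFamily R} (h : HasCoherentGadgets gatesT 𝓕) :
    𝓕.HasSuperpolynomialTransients := by
  obtain ⟨K, T, hT, hsim⟩ := h.exists_simulation gatesT_finite
  refine ⟨1 / 4, by norm_num, K * 63, 1 / (8 * Real.exp 1), by positivity, fun n hn => ?_⟩
  obtain ⟨m, -, W, hW, hWn, x, t, ht, hx⟩ := exists_wiring_long_transient hn
  obtain ⟨m', hm', G, hG, Φ, hΦ, hstep⟩ := hsim W hW
  refine ⟨m', hm'.trans (by rw [mul_assoc]; exact Nat.mul_le_mul_left _ hWn), G, hG, Φ x, T * t,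
    ht.trans ?_, fun hlim => hx ?_⟩
  · exact_mod_cast Nat.le_mul_of_pos_left t hT
  · rw [← map_iterate_of_map_step hstep] at hlim
    exact mem_periodicPts_of_map_step hΦ hstep (G.limitSet_subset_periodicPts hlim)

theorem mainTheorem12 :
    -- networks of gates from the set have super-polynomial transients
    (gateNetworks gatesT).HasSuperpolynomialTransients ∧
    -- so does every family with coherent gadgets for this set
    (∀ (R : Type) [Finite R] (𝓕 : NetworkFamily R),
      HasCoherentGadgets gatesT 𝓕 → 𝓕.HasSuperpolynomialTransients) ∧
    -- the family is not universal, even if effectivity of the simulation is dropped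
    (∀ Δ : ℕ, ¬ (gateNetworkRepresentation gatesT Δ).IsUniversal) ∧
    ¬ (gateNetworks gatesT).IsNonuniformlyUniversal ∧
    -- traces of periodic configurations at nodes of strongly connected components
    (∀ (n : ℕ) (F : Network (Fin 3) (Fin n)), F ∈ gateNetworks gatesT n →
      ∀ x ∈ Function.periodicPts F, ∀ v : Fin n,
        (Relation.TransGen F.Edge v v →
          ∃ p : ℕ, 0 < p ∧ p ≤ n ∧ ∀ t : ℕ, F^[t + p] x v = 2 ↔ F^[t] x v = 2) ∧
        (Relation.TransGen F.BoolEdge v v →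
          ∃ p : ℕ, 0 < p ∧ p ≤ n ∧ p < n ^ 2 ∧ ∀ t : ℕ, F^[t + p] x v = F^[t] x v)) := by
  exact ⟨gateNetworks_gatesT_hasSuperpolynomialTransients,
    fun R _ 𝓕 h => h.hasSuperpolynomialTransients,
    fun Δ h => not_isNonuniformlyUniversal_gatesT (isNonuniformlyUniversal_of_isUniversal h),
    not_isNonuniformlyUniversal_gatesT, gateNetworks_gatesT_traces⟩
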